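/- **Conventions.** A rooted tree $T$ has $n\ge 1$ nodes and no prescribed order of children; $T_c$ is the subtree rooted at $c$. Its *rooted pathwidth* is $rpw(T)=1$ if $T$ is a single node, and otherwise $$rpw(T)=\min_{c_h}\ \max_{c}\ \{\,rpw(T_c)+\chi_{(c\neq c_h)}\,\},$$ where $c_h$ and $c$ range over the children of the root, and $\chi_{(c\ne c_h)}$ is $1$ if $c\neq c_h$ and $0$ otherwise. A *poly-line drawing* of $T$ represents nodes by points and edges by piecewise linear curves, such that all nodes and bends have integral $x$-coordinates. All drawings are required to be planar: distinct nodes are at distinct points, edges are simple curves that pass through no node other than their ends, and distinct edges meet only in common ends. A drawing is *straight-line* if no edge has a bend. It is *upward* (*strictly upward*) if every edge is $y$-monotone (strictly $y$-monotone), going down from the parent to the child. Its *width* is the smallest $W$ such that, after a translation, all $x$-coordinates of nodes and bends lie in $\{1,\dots,W\}$. If all nodes and bends also have integral $y$-coordinates, its *height* is the number of rows (horizontal lines with integral $y$-coordinate) that the drawing intersects. **Theorem.** (i) For every rooted tree $T$, the minimum width of a planar upward poly-line drawing of $T$ is exactly $rpw(T)$. (ii) There are an algorithm and a constant $C$ such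 that, for every rooted tree $T$ with $n$ nodes $0,\dots,n-1$ given by its root and parent pointers, the algorithm computes in at most $Cn$ steps a planar strictly-upward straight-line drawing of $T$, with integral coordinates, of (optimal) width $rpw(T)$ and height $n$, with the root in the top-left corner of the drawing. Here an algorithm is a program, not depending on $T$ or $n$, of a random access machine with unit cost for addition, truncated subtraction, comparison, and reading or writing a memory cell, and all values and addresses that it writes are at most $Cn$. -/

import Mathlib

namespace TreeDrawing

/-! ### Rooted trees and rooted pathwidth -/

/-- A rooted (unordered) tree with node set `Fin n`, given by its parent pointers:
the root points to itself, and following parents from any node leads to the root. -/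
structure RTree (n : ℕ) where
  root : Fin n
  parent : Fin n → Fin n
  parent_root : parent root = root
  reaches_root : ∀ v, ∃ k : ℕ, parent^[k] v = root

namespace RTree

variable {n : ℕ} (T : RTree n)

/-- The children of the node `v`. -/
def children (v : Fin n) : Finset (Fin n) :=
  Finset.univ.filter fun c => c ≠ T.root ∧ T.parent c = v

/-- The distance of the node `v` from the root. -/
def depth (v : Fin n) : ℕ := Nat.find (T.reaches_root v)

theorem depth_lt_of_mem_children {v c : Fin n} (h : c ∈ T.children v) :
    T.depth v < T.depth c := by
  obtain ⟨hc, rfl⟩ := (Finset.mem_filter.1 h).2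
  have hs : T.parent^[T.depth c] c = T.root := Nat.find_spec (T.reaches_root c)
  obtain ⟨k, hk⟩ : ∃ k, T.depth c = k + 1 := by
    refine Nat.exists_eq_succ_of_ne_zero fun h0 => hc ?_
    rw [h0] at hs
    exact hs
  rw [hk, Function.iterate_succ_apply] at hs
  have : T.depth (T.parent c) ≤ k := Nat.find_min' (T.reaches_root (T.parent c)) hs
  omega

theorem wellFounded_depth : WellFounded fun c v : Fin n => T.depth v < T.depth c :=
  haveI : IsTrans (Fin n) fun c v => T.depth v < T.depth c := ⟨fun _ _ _ h h' => h'.trans h⟩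
  haveI : Std.Irrefl fun c v : Fin n => T.depth v < T.depth c := ⟨fun _ h => lt_irrefl _ h⟩
  Finite.wellFounded_of_trans_of_irrefl _

/-- The rooted pathwidth of the subtree rooted at `v`; see `rpwAt_eq` for the recursion
in plain form. -/
noncomputable def rpwAt : Fin n → ℕ :=
  T.wellFounded_depth.fix fun v ih =>
    if hv : (T.children v).Nonempty then
      (T.children v).inf' hv fun h =>
        (T.children v).attach.sup fun c =>
          ih c.1 (T.depth_lt_of_mem_children c.2) + if c.1 = h then 0 else 1
    else 1

/-- The rooted pathwidth is `1` at a leaf; at any other node it is the minimum, over the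
choices of one child `h`, of the maximum, over all children `c`, of the rooted pathwidth at
`c` plus `1` if `c ≠ h`. -/
theorem rpwAt_eq (v : Fin n) :
    T.rpwAt v =
      if hv : (T.children v).Nonempty then
        (T.children v).inf' hv fun h =>
          (T.children v).sup fun c => T.rpwAt c + if c = h then 0 else 1
      else 1 := by
  unfold rpwAt
  rw [WellFounded.fix_eq]
  split_ifs with hv
  · refine Finset.inf'_congr hv rfl fun h _ => ?_
    exact Finset.sup_attach (T.children v) fun c =>
      T.wellFounded_depth.fix _ c + if c = h then 0 else 1
  · rfl

/-- The rooted pathwidth of the tree. -/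
noncomputable def rpw : ℕ := T.rpwAt T.root

end RTree

/-! ### Poly-line drawings -/

/-- The point of the plane with integral `x`-coordinate `p.1` and `y`-coordinate `p.2`. -/
def toPlane (p : ℤ × ℝ) : ℝ × ℝ := ((p.1 : ℝ), p.2)

/-- The piecewise linear curve through the listed points. -/
def polyline : List (ℝ × ℝ) → Set (ℝ × ℝ)
  | [] => ∅
  | [a] => {a}
  | a :: b :: l => segment ℝ a b ∪ polyline (b :: l)

/-- The piecewise linear curve through the listed points does not touch or cross itself:
every segment is non-degenerate and meets the rest of the curve only where the latter starts. -/
def IsSimplePolyline : List (ℝ × ℝ) → Prop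
  | [] => True
  | [_] => True
  | a :: b :: l => a ≠ b ∧ segment ℝ a b ∩ polyline (b :: l) ⊆ {b} ∧ IsSimplePolyline (b :: l)

/-- A poly-line drawing of a rooted tree: a point for every node, and for every node `v` other
than the root the list of bends, from the parent of `v` down to `v`, of the edge that joins
the two (`bends T.root` is never used). Nodes and bends have integral `x`-coordinates. -/
structure Drawing {n : ℕ} (T : RTree n) where
  pos : Fin n → ℤ × ℝ
  bends : Fin n → List (ℤ × ℝ)

namespace Drawing

variable {n : ℕ} {T : RTree n} (Γ : Drawing T)

/-- The end, the bends and the other end of the edge from the parent of `v` to `v`. -/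
def edgePoints (v : Fin n) : List (ℤ × ℝ) :=
  Γ.pos (T.parent v) :: (Γ.bends v ++ [Γ.pos v])

/-- The curve that represents the edge from the parent of `v` to `v`, as a set of points. -/
def edgeCurve (v : Fin n) : Set (ℝ × ℝ) :=
  polyline ((Γ.edgePoints v).map toPlane)

/-- No two nodes coincide, every edge is a simple curve, no edge passes through a node that is
not one of its ends, and distinct edges meet only in common ends. -/
structure IsPlanar : Prop where
  pos_injective : Function.Injective Γ.pos
  simple : ∀ v, v ≠ T.root → IsSimplePolyline ((Γ.edgePoints v).map toPlane)
  node_edge : ∀ v w, v ≠ T.root → toPlane (Γ.pos w) ∈ Γ.edgeCurve v →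
    w = v ∨ w = T.parent v
  edge_edge : ∀ v w, v ≠ T.root → w ≠ T.root → v ≠ w →
    ∀ p ∈ Γ.edgeCurve v ∩ Γ.edgeCurve w,
      ∃ u, p = toPlane (Γ.pos u) ∧ (u = v ∨ u = T.parent v) ∧ (u = w ∨ u = T.parent w)

/-- Every edge is `y`-monotone: it never goes up on its way from the parent to the child
(horizontal pieces are allowed). -/
def IsUpward : Prop :=
  ∀ v, v ≠ T.root → (Γ.edgePoints v).Pairwise fun p q => q.2 ≤ p.2

/-- Every edge is strictly `y`-monotone, descending from the parent to the child. -/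
def IsStrictlyUpward : Prop :=
  ∀ v, v ≠ T.root → (Γ.edgePoints v).Pairwise fun p q => q.2 < p.2

/-- No edge has a bend. -/
def IsStraightLine : Prop :=
  ∀ v, v ≠ T.root → Γ.bends v = []

/-- The nodes and bends of the drawing. -/
def vertices : Set (ℤ × ℝ) :=
  {p | ∃ v, p = Γ.pos v ∨ (v ≠ T.root ∧ p ∈ Γ.bends v)}

/-- The smallest `W` such that, after a translation, all `x`-coordinates of nodes and bends lie
between `1` and `W`. -/
noncomputable def width : ℕ :=
  sInf {W : ℕ | ∃ a : ℤ, ∀ p ∈ Γ.vertices, 1 ≤ p.1 + a ∧ p.1 + a ≤ W}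

/-- All nodes and bends have integral `y`-coordinates as well. -/
def IsGrid : Prop :=
  ∀ p ∈ Γ.vertices, ∃ j : ℤ, p.2 = j

/-- All points of the plane that are covered by nodes and edges. -/
def support : Set (ℝ × ℝ) :=
  {p | ∃ v, p = toPlane (Γ.pos v) ∨ (v ≠ T.root ∧ p ∈ Γ.edgeCurve v)}

/-- The number of rows (horizontal lines at integral height) that the drawing intersects. -/
noncomputable def height : ℕ :=
  Set.ncard {j : ℤ | ∃ p ∈ Γ.support, p.2 = j}

/-- The root lies in the top-left corner of the bounding box of the drawing. -/
def RootTopLeft : Prop :=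
  ∀ p ∈ Γ.vertices, (Γ.pos T.root).1 ≤ p.1 ∧ p.2 ≤ (Γ.pos T.root).2

end Drawing

/-- The straight-line drawing with node `v` at the point `(X v, Y v)`. -/
def straightDrawing {n : ℕ} (T : RTree n) (X Y : ℕ → ℕ) : Drawing T where
  pos v := ((X v : ℤ), (Y v : ℝ))
  bends _ := []

/-! ### Random access machines with unit cost and bounded word size -/

/-- The memory: scalar variables `var x`, and arrays with cells `arr a i`
(a program mentions finitely many variables and arrays). -/
structure Memory where
  var : ℕ → ℕ
  arr : ℕ → ℕ → ℕ

/-- Expressions: constants, variables, array look-up `a[e]`, addition, truncated subtraction,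
and the comparisons `e < f` and `e = f` with value `1` or `0`. -/
inductive Expr where
  | const (k : ℕ)
  | var (x : ℕ)
  | get (a : ℕ) (e : Expr)
  | add (e f : Expr)
  | sub (e f : Expr)
  | lt (e f : Expr)
  | eq (e f : Expr)

namespace Expr

def eval (s : Memory) : Expr → ℕ
  | const k => k
  | var x => s.var x
  | get a e => s.arr a (e.eval s)
  | add e f => e.eval s + f.eval s
  | sub e f => e.eval s - f.eval s
  | lt e f => if e.eval s < f.eval s then 1 else 0
  | eq e f => if e.eval s = f.eval s then 1 else 0

/-- The number of elementary operations in the evaluation of an expression. -/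
def cost : Expr → ℕ
  | const _ => 1
  | var _ => 1
  | get _ e => e.cost + 1
  | add e f => e.cost + f.cost + 1
  | sub e f => e.cost + f.cost + 1
  | lt e f => e.cost + f.cost + 1
  | eq e f => e.cost + f.cost + 1

end Expr

/-- Programs: `assign x e` is `x := e`, and `store a i e` is `a[i] := e`; a condition `e` holds
if its value is not `0`. -/
inductive Program where
  | skip
  | assign (x : ℕ) (e : Expr)
  | store (a : ℕ) (i e : Expr)
  | seq (P Q : Program)
  | branch (e : Expr) (P Q : Program)
  | loop (e : Expr) (P : Program)

def Memory.setVar (s : Memory) (x k : ℕ) : Memory :=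
  { s with var := Function.update s.var x k }

def Memory.setArr (s : Memory) (a i k : ℕ) : Memory :=
  { s with arr := Function.update s.arr a (Function.update (s.arr a) i k) }

/-- `Exec B P s t s'`: started with memory `s`, the program `P` halts after exactly `t` elementary
steps with memory `s'`, and all values and addresses that it writes are at most `B`. -/
inductive Exec (B : ℕ) : Program → Memory → ℕ → Memory → Prop where
  | skip (s : Memory) : Exec B .skip s 1 s
  | assign (x : ℕ) (e : Expr) (s : Memory) (he : e.eval s ≤ B) :
      Exec B (.assign x e) s (e.cost + 1) (s.setVar x (e.eval s))
  | store (a : ℕ) (i e : Expr) (s : Memory) (hi : i.eval s ≤ B) (he : e.eval s ≤ B) :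
      Exec B (.store a i e) s (i.cost + e.cost + 1) (s.setArr a (i.eval s) (e.eval s))
  | seq {P Q : Program} {s s' s'' : Memory} {t t' : ℕ} (hP : Exec B P s t s')
      (hQ : Exec B Q s' t' s'') : Exec B (.seq P Q) s (t + t') s''
  | branch_true {e : Expr} {P Q : Program} {s s' : Memory} {t : ℕ} (he : e.eval s ≠ 0)
      (hP : Exec B P s t s') : Exec B (.branch e P Q) s (e.cost + 1 + t) s'
  | branch_false {e : Expr} {P Q : Program} {s s' : Memory} {t : ℕ} (he : e.eval s = 0)
      (hQ : Exec B Q s t s') : Exec B (.branch e P Q) s (e.cost + 1 + t) s'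
  | loop_true {e : Expr} {P : Program} {s s' s'' : Memory} {t t' : ℕ} (he : e.eval s ≠ 0)
      (hP : Exec B P s t s') (hL : Exec B (.loop e P) s' t' s'') :
      Exec B (.loop e P) s (e.cost + 1 + t + t') s''
  | loop_false {e : Expr} {P : Program} {s : Memory} (he : e.eval s = 0) :
      Exec B (.loop e P) s (e.cost + 1) s

/-- The input of the algorithm: variable `0` holds the number of nodes, variable `1` the root,
array `0` the parent pointers, and the rest of the memory is zero. -/
def RTree.input {n : ℕ} (T : RTree n) : Memory where
  var x := if x = 0 then n else if x = 1 then (T.root : ℕ) else 0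
  arr a i := if h : a = 0 ∧ i < n then (T.parent ⟨i, h.2⟩ : ℕ) else 0

/-- The output of the algorithm: arrays `1` and `2` hold the coordinates of the nodes in a
straight-line drawing. -/
def Memory.output (s : Memory) {n : ℕ} (T : RTree n) : Drawing T :=
  straightDrawing T (s.arr 1) (s.arr 2)

end TreeDrawing

/-!
The rooted pathwidth exceeds that of all children only at nodes with two children of maximal rooted
pathwidth; it is the Horton–Strahler number of the tree.

*Lower bound.* Suppose two children `a` and `b` of a node `v` both have subtrees that need all of
the available columns. Then both subtrees touch the leftmost and the rightmost column. If the
subtree of `a` contains a lowest node `u` of the two, the path from `v` down to `u` is a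
`y`-monotone curve, which separates the strip between the rows of `v` and `u` into a left and a
right part, both open (`DescendingCurve.not_disjoint`). The curve of the subtree of `b` is
connected, lies in that strip and touches both sides, so it meets the path, and the drawing is not
planar (`IsPlanar.not_spanning`). Hence one more column is needed whenever the rooted pathwidth
grows.

*Construction.* Choose, for each inner node, one child of maximal rooted pathwidth as its heavy
child. List the nodes in preorder, visiting the heavy child last, and give each node its own row in
this order, from top to bottom. A heavy child goes to the column of its parent, every other child
one column to the right. So the column of a node is the number of non-heavy steps on its path from
the root, each of which lowers the rooted pathwidth. Every edge is vertical or joins neighbouring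
columns. The drawing is planar because no node in the column of the parent of `c` is in a row
strictly between that parent and `c` (`Layout.Y_le`): a lower node of that column is in the heavy
subtree, which is visited last, or below the whole subtree of the parent.

*Algorithm.* Peel off leaves with a queue, so that children are treated before parents. This yields
the subtree sizes, the heavy children, and for each node the number of nodes in the subtrees of its
siblings treated before (`Collected`). Sizes stay bounded since the sum of `sz v + 1` over the
untreated nodes is constant. The reverse order of the queue has parents before children, and each
node is then placed relative to its parent (`Placed`). All loops are counted, so a
weakest-precondition calculus for loop-free programs and one rule for counted loops suffice
(`Program.Runs.loop`).
-/

namespace TreeDrawing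

/-! ### Descendants and rooted pathwidth -/

namespace RTree

variable {n : ℕ} (T : RTree n)

theorem mem_children {v c : Fin n} : c ∈ T.children v ↔ c ≠ T.root ∧ T.parent c = v := by
  simp [children]

/-- `T.Desc v w` says that `w` is a node of the subtree rooted at `v`. -/
def Desc (v w : Fin n) : Prop :=
  Relation.ReflTransGen (fun p c => c ∈ T.children p) v w

theorem desc_root (w : Fin n) : T.Desc T.root w := by
  obtain ⟨k, hk⟩ := T.reaches_root w
  induction k generalizing w with
  | zero => rw [← hk]; exact .refl
  | succ k ih =>
    by_cases hw : w = T.root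
    · rw [hw]; exact .refl
    · exact (ih (T.parent w) hk).tail (T.mem_children.2 ⟨hw, rfl⟩)

theorem Desc.depth_le {v w : Fin n} (h : T.Desc v w) : T.depth v ≤ T.depth w := by
  induction h with
  | refl => exact le_rfl
  | tail _ hc ih => exact ih.trans (T.depth_lt_of_mem_children hc).le

theorem Desc.parent {v w : Fin n} (h : T.Desc v w) (hw : w ≠ v) :
    w ≠ T.root ∧ T.Desc v (T.parent w) := by
  rcases Relation.ReflTransGen.cases_tail h with h | ⟨u, hu, hc⟩
  · exact absurd h hw
  · obtain ⟨h1, rfl⟩ := T.mem_children.1 hc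
    exact ⟨h1, hu⟩

theorem Desc.exists_child {v w : Fin n} (h : T.Desc v w) (hw : w ≠ v) :
    ∃ c ∈ T.children v, T.Desc c w := by
  rcases Relation.ReflTransGen.cases_head h with h | h
  · exact absurd h.symm hw
  · exact h

theorem not_desc_of_mem_children {v c : Fin n} (hc : c ∈ T.children v) : ¬ T.Desc c v := fun h =>
  absurd (Desc.depth_le T h) (T.depth_lt_of_mem_children hc).not_ge

/-- Distinct children of a node root disjoint subtrees. -/
theorem Desc.false_of_siblings {v c d w : Fin n} (hc : c ∈ T.children v) (hd : d ∈ T.children v)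
    (hcd : c ≠ d) (h : T.Desc c w) (h' : T.Desc d w) : False := by
  have key : ∀ {a b : Fin n}, a ∈ T.children v → b ∈ T.children v → a ≠ b → ¬ T.Desc a b := by
    intro a b ha hb hab hdesc
    have := (Desc.parent T hdesc hab.symm).2
    rw [(T.mem_children.1 hb).2] at this
    exact T.not_desc_of_mem_children ha this
  induction h with
  | refl => exact key hd hc hcd.symm h'
  | @tail u w hu hw ih =>
    by_cases hwd : w = d
    · subst hwd
      exact key hc hd hcd (Relation.ReflTransGen.tail hu hw)
    · have := (Desc.parent T h' hwd).2
      rw [(T.mem_children.1 hw).2] at this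
      exact ih this

theorem rpwAt_le_of_mem_children {v c : Fin n} (hc : c ∈ T.children v) :
    T.rpwAt c ≤ T.rpwAt v := by
  rw [T.rpwAt_eq v, dif_pos (show (T.children v).Nonempty from ⟨c, hc⟩), Finset.le_inf'_iff]
  intro h _
  exact (Nat.le_add_right _ _).trans
    (Finset.le_sup (f := fun c => T.rpwAt c + if c = h then 0 else 1) hc)

theorem one_le_rpwAt (v : Fin n) : 1 ≤ T.rpwAt v := by
  induction v using T.wellFounded_depth.induction with
  | _ v ih =>
    by_cases hv : (T.children v).Nonempty
    · obtain ⟨c, hc⟩ := hv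
      exact (ih c (T.depth_lt_of_mem_children hc)).trans (T.rpwAt_le_of_mem_children hc)
    · rw [T.rpwAt_eq, dif_neg hv]

theorem succ_le_rpwAt {v c d : Fin n} (hc : c ∈ T.children v) (hd : d ∈ T.children v)
    (hcd : c ≠ d) {k : ℕ} (hkc : k ≤ T.rpwAt c) (hkd : k ≤ T.rpwAt d) :
    k + 1 ≤ T.rpwAt v := by
  rw [T.rpwAt_eq v, dif_pos (show (T.children v).Nonempty from ⟨c, hc⟩), Finset.le_inf'_iff]
  intro h _
  have hle := fun {a} (ha : a ∈ T.children v) =>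
    Finset.le_sup (f := fun c => T.rpwAt c + if c = h then 0 else 1) (b := a) ha
  by_cases hch : c = h
  · have := hle hd
    rw [if_neg (by rintro rfl; exact hcd hch)] at this
    omega
  · have := hle hc
    rw [if_neg hch] at this
    omega

/-- The rooted pathwidth of an inner node is attained by a child, or exceeds by one the smaller
of the rooted pathwidths of two children. -/
theorem exists_rpwAt_le {v : Fin n} (hv : (T.children v).Nonempty) :
    ∃ h ∈ T.children v, T.rpwAt v ≤ T.rpwAt h ∨
      ∃ c ∈ T.children v, c ≠ h ∧ T.rpwAt c ≤ T.rpwAt h ∧ T.rpwAt v ≤ T.rpwAt c + 1 := by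
  obtain ⟨h, hh, hmax⟩ := Finset.exists_max_image _ T.rpwAt hv
  refine ⟨h, hh, ?_⟩
  have hle : T.rpwAt v ≤ (T.children v).sup fun c => T.rpwAt c + if c = h then 0 else 1 := by
    rw [T.rpwAt_eq v, dif_pos hv]
    exact Finset.inf'_le _ hh
  obtain ⟨c, hc, hsup⟩ := Finset.exists_mem_eq_sup _ hv
    fun c => T.rpwAt c + if c = h then 0 else 1
  rw [hsup] at hle
  by_cases hch : c = h
  · left
    simpa [hch] using hle
  · right
    exact ⟨c, hc, hch, hmax c hc, by simpa [hch] using hle⟩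

end RTree

/-! ### Descending curves -/

/-- A curve from `p` to `q` that never goes up, as a set of points: what matters is that its
intersection with every horizontal line is an interval. -/
structure DescendingCurve (S : Set (ℝ × ℝ)) (p q : ℝ × ℝ) : Prop where
  isCompact : IsCompact S
  isPreconnected : IsPreconnected S
  start_mem : p ∈ S
  end_mem : q ∈ S
  le_start : ∀ z ∈ S, z.2 ≤ p.2
  end_le : ∀ z ∈ S, q.2 ≤ z.2
  slice : ∀ y, IsPreconnected (S ∩ {z | z.2 = y})

theorem convex_row (y : ℝ) : Convex ℝ {z : ℝ × ℝ | z.2 = y} :=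
  (convex_singleton y).is_linear_preimage (f := fun z : ℝ × ℝ => z.2)
    ⟨fun _ _ => rfl, fun _ _ => rfl⟩

theorem convex_fst_Icc (a b : ℝ) : Convex ℝ {z : ℝ × ℝ | z.1 ∈ Set.Icc a b} :=
  (convex_Icc a b).is_linear_preimage (f := fun z : ℝ × ℝ => z.1) ⟨fun _ _ => rfl, fun _ _ => rfl⟩

theorem convex_snd_Icc (a b : ℝ) : Convex ℝ {z : ℝ × ℝ | z.2 ∈ Set.Icc a b} :=
  (convex_Icc a b).is_linear_preimage (f := fun z : ℝ × ℝ => z.2) ⟨fun _ _ => rfl, fun _ _ => rfl⟩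

/-- The points to the left of a compact set form an open set. -/
theorem isOpen_left_of {S : Set (ℝ × ℝ)} (hS : IsCompact S) :
    IsOpen {z : ℝ × ℝ | ∀ s ∈ S, s.2 = z.2 → z.1 < s.1} := by
  have hC : IsClosed {w : ℝ × ℝ | 0 ≤ w.1 ∧ w.2 = 0} :=
    (isClosed_le continuous_const continuous_fst).inter
      (isClosed_eq continuous_snd continuous_const)
  rw [← isClosed_compl_iff]
  convert hC.add_left_of_isCompact hS using 1
  ext z
  simp only [Set.mem_compl_iff, Set.mem_ofPred_eq, Set.mem_add, not_forall, not_lt]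
  constructor
  · rintro ⟨s, hs, h2, h1⟩
    exact ⟨s, hs, z - s, ⟨by simpa using h1, by simp [h2]⟩, by simp⟩
  · rintro ⟨s, hs, w, ⟨h1, h2⟩, rfl⟩
    exact ⟨s, hs, by simp [h2], by simpa using h1⟩

/-- The points to the right of a compact set form an open set. -/
theorem isOpen_right_of {S : Set (ℝ × ℝ)} (hS : IsCompact S) :
    IsOpen {z : ℝ × ℝ | ∀ s ∈ S, s.2 = z.2 → s.1 < z.1} := by
  have hC : IsClosed {w : ℝ × ℝ | w.1 ≤ 0 ∧ w.2 = 0} :=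
    (isClosed_le continuous_fst continuous_const).inter
      (isClosed_eq continuous_snd continuous_const)
  rw [← isClosed_compl_iff]
  convert hC.add_left_of_isCompact hS using 1
  ext z
  simp only [Set.mem_compl_iff, Set.mem_ofPred_eq, Set.mem_add, not_forall, not_lt]
  constructor
  · rintro ⟨s, hs, h2, h1⟩
    exact ⟨s, hs, z - s, ⟨by simpa using h1, by simp [h2]⟩, by simp⟩
  · rintro ⟨s, hs, w, ⟨h1, h2⟩, rfl⟩
    exact ⟨s, hs, by simp [h2], by simpa using h1⟩

namespace DescendingCurve

variable {S S' B : Set (ℝ × ℝ)} {p q r : ℝ × ℝ}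

theorem segment (h : q.2 ≤ p.2) : DescendingCurve (segment ℝ p q) p q := by
  have hsub : _root_.segment ℝ p q ⊆ {z : ℝ × ℝ | z.2 ∈ Set.Icc q.2 p.2} :=
    (convex_snd_Icc q.2 p.2).segment_subset ⟨h, le_rfl⟩ ⟨le_rfl, h⟩
  refine ⟨?_, (convex_segment p q).isPreconnected, left_mem_segment ℝ p q,
    right_mem_segment ℝ p q, fun z hz => (hsub hz).2, fun z hz => (hsub hz).1,
    fun y => ((convex_segment p q).inter (convex_row y)).isPreconnected⟩
  rw [segment_eq_image_lineMap]
  exact isCompact_Icc.image AffineMap.lineMap_continuous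

theorem singleton (p : ℝ × ℝ) : DescendingCurve {p} p p := by
  simpa using segment (le_refl p.2)

/-- Descending curves can be concatenated. -/
theorem union (h : DescendingCurve S p q) (h' : DescendingCurve S' q r) :
    DescendingCurve (S ∪ S') p r where
  isCompact := h.isCompact.union h'.isCompact
  isPreconnected := h.isPreconnected.union q h.end_mem h'.start_mem h'.isPreconnected
  start_mem := .inl h.start_mem
  end_mem := .inr h'.end_mem
  le_start z hz := hz.elim (h.le_start z)
    fun hz => (h'.le_start z hz).trans (h.le_start q h.end_mem)
  end_le z hz := hz.elim
    (fun hz => (h'.end_le q h'.start_mem).trans (h.end_le z hz)) (h'.end_le z)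
  slice y := by
    rw [Set.union_inter_distrib_right]
    rcases lt_trichotomy y q.2 with hy | hy | hy
    · have : S ∩ {z | z.2 = y} = ∅ := by
        ext z
        simp only [Set.mem_inter_iff, Set.mem_ofPred_eq, Set.mem_empty_iff_false, iff_false]
        rintro ⟨hz, rfl⟩
        exact (h.end_le z hz).not_gt hy
      rw [this, Set.empty_union]
      exact h'.slice y
    · exact (h.slice y).union q ⟨h.end_mem, hy.symm⟩ ⟨h'.start_mem, hy.symm⟩ (h'.slice y)
    · have : S' ∩ {z | z.2 = y} = ∅ := by
        ext z
        simp only [Set.mem_inter_iff, Set.mem_ofPred_eq, Set.mem_empty_iff_false, iff_false]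
        rintro ⟨hz, rfl⟩
        exact (h'.le_start z hz).not_gt hy
      rw [this, Set.union_empty]
      exact h.slice y

theorem polyline (p : ℝ × ℝ) (l : List (ℝ × ℝ)) (q : ℝ × ℝ)
    (h : (p :: (l ++ [q])).Pairwise fun a b => b.2 ≤ a.2) :
    DescendingCurve (polyline (p :: (l ++ [q]))) p q := by
  induction l generalizing p with
  | nil =>
    have hpq : q.2 ≤ p.2 := by simpa using h
    exact (segment hpq).union (singleton q)
  | cons b l ih =>
    rw [List.cons_append, List.pairwise_cons] at h
    exact (segment (h.1 b (by simp))).union (ih b h.2)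

/-- A descending curve from the top to the bottom of a rectangle meets every connected set in the
rectangle that touches its left and its right side. -/
theorem not_disjoint (h : DescendingCurve S p q) (hB : IsPreconnected B) {a b : ℝ}
    (hS : ∀ z ∈ S, z.1 ∈ Set.Icc a b) (hBy : ∀ z ∈ B, z.2 ∈ Set.Icc q.2 p.2)
    (hleft : ∃ z ∈ B, z.1 = a) (hright : ∃ z ∈ B, z.1 = b) : ¬ Disjoint B S := by
  intro hdisj
  have hmeet : ∀ z ∈ B, ∃ s ∈ S, s.2 = z.2 := by
    intro z hz
    have := (h.isPreconnected.image Prod.snd continuous_snd.continuousOn).ordConnected.out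
      ⟨q, h.end_mem, rfl⟩ ⟨p, h.start_mem, rfl⟩ (hBy z hz)
    exact this
  obtain ⟨z₁, hz₁, rfl⟩ := hleft
  obtain ⟨z₂, hz₂, rfl⟩ := hright
  have hne : ∀ z ∈ B, ∀ s ∈ S, s.2 = z.2 → s.1 ≠ z.1 := fun z hz s hs h2 h1 =>
    Set.disjoint_left.1 hdisj hz (by rwa [← Prod.ext h1 h2])
  have hcover : B ⊆ {z | ∀ s ∈ S, s.2 = z.2 → z.1 < s.1} ∪
      {z | ∀ s ∈ S, s.2 = z.2 → s.1 < z.1} := by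
    intro z hz
    by_contra hcon
    simp only [Set.mem_union, Set.mem_ofPred_eq, not_or, not_forall, not_lt] at hcon
    obtain ⟨⟨s, hs, h2, h1⟩, ⟨s', hs', h2', h1'⟩⟩ := hcon
    obtain ⟨w, ⟨hw, hw2⟩, hw1⟩ := ((h.slice z.2).image Prod.fst
      continuous_fst.continuousOn).ordConnected.out ⟨s, ⟨hs, h2⟩, rfl⟩ ⟨s', ⟨hs', h2'⟩, rfl⟩
      ⟨h1, h1'⟩
    exact hne z hz w hw hw2 hw1
  obtain ⟨z, hz, hzl, hzr⟩ := hB _ _ (isOpen_left_of h.isCompact) (isOpen_right_of h.isCompact)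
    hcover ⟨z₁, hz₁, fun s hs h2 => (hS s hs).1.lt_of_ne (hne z₁ hz₁ s hs h2).symm⟩
    ⟨z₂, hz₂, fun s hs h2 => (hS s hs).2.lt_of_ne (hne z₂ hz₂ s hs h2)⟩
  obtain ⟨s, hs, h2⟩ := hmeet z hz
  exact lt_asymm (hzl s hs h2) (hzr s hs h2)

end DescendingCurve

theorem polyline_subset {s : Set (ℝ × ℝ)} (hs : Convex ℝ s) :
    ∀ l : List (ℝ × ℝ), (∀ z ∈ l, z ∈ s) → polyline l ⊆ s
  | [], _ => Set.empty_subset _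
  | [a], h => by simpa [polyline] using h
  | a :: b :: l, h => Set.union_subset (hs.segment_subset (h a (by simp)) (h b (by simp)))
      (polyline_subset hs (b :: l) fun z hz => h z (by simp_all))

theorem mem_polyline {z : ℝ × ℝ} : ∀ {l : List (ℝ × ℝ)}, z ∈ l → z ∈ polyline l
  | [a], h => by simpa [polyline] using h
  | a :: b :: l, h => by
    rcases List.mem_cons.1 h with rfl | h
    · exact .inl (left_mem_segment ℝ _ _)
    · exact .inr (mem_polyline h)

/-! ### Upward drawings have at least the rooted pathwidth as width -/

namespace Drawing

variable {n : ℕ} {T : RTree n} (Γ : Drawing T)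

/-- The part of the drawing that represents the subtree rooted at `v`. -/
def treeCurve (v : Fin n) : Set (ℝ × ℝ) :=
  {z | z = toPlane (Γ.pos v) ∨ ∃ w, T.Desc v w ∧ w ≠ v ∧ z ∈ Γ.edgeCurve w}

variable {Γ}

theorem parent_mem_edgeCurve (v : Fin n) : toPlane (Γ.pos (T.parent v)) ∈ Γ.edgeCurve v :=
  mem_polyline (List.mem_map_of_mem (by simp [edgePoints]))

theorem node_mem_edgeCurve (v : Fin n) : toPlane (Γ.pos v) ∈ Γ.edgeCurve v :=
  mem_polyline (List.mem_map_of_mem (by simp [edgePoints]))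

theorem bend_mem_edgeCurve {v : Fin n} {b : ℤ × ℝ} (hb : b ∈ Γ.bends v) :
    toPlane b ∈ Γ.edgeCurve v :=
  mem_polyline (List.mem_map_of_mem (by simp [edgePoints, hb]))

theorem IsUpward.edgeCurve (h : Γ.IsUpward) {v : Fin n} (hv : v ≠ T.root) :
    DescendingCurve (Γ.edgeCurve v) (toPlane (Γ.pos (T.parent v))) (toPlane (Γ.pos v)) := by
  have := DescendingCurve.polyline (toPlane (Γ.pos (T.parent v))) ((Γ.bends v).map toPlane)
    (toPlane (Γ.pos v)) (by
      have := List.Pairwise.map (S := fun a b : ℝ × ℝ => b.2 ≤ a.2) toPlane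
        (fun a b hab => hab) (h v hv)
      simpa [edgePoints] using this)
  simpa [Drawing.edgeCurve, edgePoints] using this

theorem node_mem_treeCurve {v w : Fin n} (h : T.Desc v w) :
    toPlane (Γ.pos w) ∈ Γ.treeCurve v := by
  by_cases hw : w = v
  · exact .inl (by rw [hw])
  · exact .inr ⟨w, h, hw, node_mem_edgeCurve w⟩

/-- The tree path from a node down to a descendant is drawn as a descending curve. -/
theorem IsUpward.exists_path (h : Γ.IsUpward) {v w : Fin n} (hw : T.Desc v w) :
    ∃ S ⊆ Γ.treeCurve v, DescendingCurve S (toPlane (Γ.pos v)) (toPlane (Γ.pos w)) := by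
  induction hw with
  | refl => exact ⟨{toPlane (Γ.pos v)}, by rintro _ rfl; exact .inl rfl, .singleton _⟩
  | @tail u w hu hw ih =>
    obtain ⟨S, hS, hd⟩ := ih
    obtain ⟨hr, rfl⟩ := T.mem_children.1 hw
    have hwv : w ≠ v := by
      rintro rfl
      exact T.not_desc_of_mem_children hw hu
    refine ⟨S ∪ Γ.edgeCurve w, Set.union_subset hS fun z hz => .inr ⟨w, ?_, hwv, hz⟩,
      hd.union (h.edgeCurve hr)⟩
    exact Relation.ReflTransGen.tail hu hw

theorem IsUpward.exists_path_of_mem (h : Γ.IsUpward) {v : Fin n} {z : ℝ × ℝ}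
    (hz : z ∈ Γ.treeCurve v) : ∃ S ⊆ Γ.treeCurve v, ∃ w, T.Desc v w ∧ z ∈ S ∧
      DescendingCurve S (toPlane (Γ.pos v)) (toPlane (Γ.pos w)) := by
  rcases hz with rfl | ⟨w, hw, hwv, hz⟩
  · exact ⟨{toPlane (Γ.pos v)}, by rintro _ rfl; exact .inl rfl, v, .refl, rfl, .singleton _⟩
  · obtain ⟨hr, hp⟩ := RTree.Desc.parent T hw hwv
    obtain ⟨S, hS, hd⟩ := h.exists_path hp
    exact ⟨S ∪ Γ.edgeCurve w, Set.union_subset hS fun z hz => .inr ⟨w, hw, hwv, hz⟩, w, hw,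
      .inr hz, hd.union (h.edgeCurve hr)⟩

theorem IsUpward.isPreconnected_treeCurve (h : Γ.IsUpward) (v : Fin n) :
    IsPreconnected (Γ.treeCurve v) := by
  refine isPreconnected_of_forall (toPlane (Γ.pos v)) fun z hz => ?_
  obtain ⟨S, hS, w, _, hzS, hd⟩ := h.exists_path_of_mem hz
  exact ⟨S, hS, hd.start_mem, hzS, hd.isPreconnected⟩

variable (Γ) in
/-- All nodes and bends of the subtree rooted at `v` lie in the columns from `lo` to `hi`. -/
def InColumns (v : Fin n) (lo hi : ℤ) : Prop :=
  ∀ w, T.Desc v w → (Γ.pos w).1 ∈ Set.Icc lo hi ∧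
    (w ≠ v → ∀ b ∈ Γ.bends w, b.1 ∈ Set.Icc lo hi)

theorem InColumns.child {v c : Fin n} {lo hi : ℤ} (h : Γ.InColumns v lo hi)
    (hc : c ∈ T.children v) : Γ.InColumns c lo hi := by
  intro w hw
  have hvw : T.Desc v w := Relation.ReflTransGen.head hc hw
  refine ⟨(h w hvw).1, fun _ => (h w hvw).2 ?_⟩
  rintro rfl
  exact T.not_desc_of_mem_children hc hw

theorem InColumns.edgeCurve {v w : Fin n} {lo hi : ℤ} (h : Γ.InColumns v lo hi)
    (hw : T.Desc v w) (hwv : w ≠ v) :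
    ∀ z ∈ Γ.edgeCurve w, z.1 ∈ Set.Icc (lo : ℝ) hi := by
  refine polyline_subset (convex_fst_Icc lo hi) _ ?_
  have hp := (h _ (RTree.Desc.parent T hw hwv).2).1
  have hw' := h w hw
  simp only [edgePoints, List.mem_map, List.mem_cons, List.mem_append, List.not_mem_nil, or_false]
  rintro _ ⟨b, rfl | hb | rfl, rfl⟩
  · exact ⟨Int.cast_le.2 hp.1, Int.cast_le.2 hp.2⟩
  · exact ⟨Int.cast_le.2 (hw'.2 hwv b hb).1, Int.cast_le.2 (hw'.2 hwv b hb).2⟩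
  · exact ⟨Int.cast_le.2 hw'.1.1, Int.cast_le.2 hw'.1.2⟩

theorem InColumns.treeCurve {v : Fin n} {lo hi : ℤ} (h : Γ.InColumns v lo hi) :
    ∀ z ∈ Γ.treeCurve v, z.1 ∈ Set.Icc (lo : ℝ) hi := by
  rintro _ (rfl | ⟨w, hw, hwv, hz⟩)
  · have := (h v .refl).1
    exact ⟨Int.cast_le.2 this.1, Int.cast_le.2 this.2⟩
  · exact h.edgeCurve hw hwv _ hz

/-- The curve of a subtree that does not fit into the columns from `lo + 1` to `hi` touches the
column `lo`. -/
theorem InColumns.exists_left {v : Fin n} {lo hi : ℤ} (h : Γ.InColumns v lo hi)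
    (h' : ¬ Γ.InColumns v (lo + 1) hi) : ∃ z ∈ Γ.treeCurve v, z.1 = lo := by
  by_contra hcon
  push Not at hcon
  refine h' fun w hw => ⟨?_, fun hwv b hb => ?_⟩
  · have h1 := (h w hw).1
    have h2 : (Γ.pos w).1 ≠ lo := fun he =>
      hcon _ (node_mem_treeCurve hw) (by simp [toPlane, he])
    exact ⟨by have := h1.1; omega, h1.2⟩
  · have h1 := (h w hw).2 hwv b hb
    have h2 : b.1 ≠ lo := fun he =>
      hcon _ (.inr ⟨w, hw, hwv, bend_mem_edgeCurve hb⟩) (by simp [toPlane, he])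
    exact ⟨by have := h1.1; omega, h1.2⟩

theorem InColumns.exists_right {v : Fin n} {lo hi : ℤ} (h : Γ.InColumns v lo hi)
    (h' : ¬ Γ.InColumns v lo (hi - 1)) : ∃ z ∈ Γ.treeCurve v, z.1 = hi := by
  by_contra hcon
  push Not at hcon
  refine h' fun w hw => ⟨?_, fun hwv b hb => ?_⟩
  · have h1 := (h w hw).1
    have h2 : (Γ.pos w).1 ≠ hi := fun he =>
      hcon _ (node_mem_treeCurve hw) (by simp [toPlane, he])
    exact ⟨h1.1, by have := h1.2; omega⟩
  · have h1 := (h w hw).2 hwv b hb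
    have h2 : b.1 ≠ hi := fun he =>
      hcon _ (.inr ⟨w, hw, hwv, bend_mem_edgeCurve hb⟩) (by simp [toPlane, he])
    exact ⟨h1.1, by have := h1.2; omega⟩

/-- The edge to a child `a` and the curve of its subtree avoid the curve of the subtree of any
other child. -/
theorem IsPlanar.disjoint_siblings (h : Γ.IsPlanar) {v a b : Fin n} (ha : a ∈ T.children v)
    (hb : b ∈ T.children v) (hab : a ≠ b) :
    Disjoint (Γ.treeCurve b) (Γ.edgeCurve a ∪ Γ.treeCurve a) := by
  have hava : ∀ u, T.Desc a u → ¬ T.Desc b u := fun u h1 h2 =>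
    RTree.Desc.false_of_siblings T ha hb hab h1 h2
  have hvb : ¬ T.Desc b v := T.not_desc_of_mem_children hb
  -- The ends of an edge below `v` on the side of `a` are not descendants of `b`.
  have hends : ∀ u, T.Desc a u → u ≠ T.root ∧ ¬ T.Desc b u ∧ ¬ T.Desc b (T.parent u) := by
    intro u hu
    by_cases hua : u = a
    · subst hua
      obtain ⟨h1, h2⟩ := T.mem_children.1 ha
      exact ⟨h1, hava u hu, by rwa [h2]⟩
    · obtain ⟨h1, h2⟩ := RTree.Desc.parent T hu hua
      exact ⟨h1, hava u hu, hava _ h2⟩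
  have key : ∀ u, T.Desc a u → ∀ z ∈ Γ.edgeCurve u, z ∉ Γ.treeCurve b := by
    rintro u hu z hz (rfl | ⟨w, hw, hwb, hzw⟩)
    · obtain ⟨hr, h1, h2⟩ := hends u hu
      rcases h.node_edge u b hr hz with rfl | rfl
      · exact h1 .refl
      · exact h2 .refl
    · obtain ⟨hr, h1, h2⟩ := hends u hu
      obtain ⟨hwr, hwp⟩ := RTree.Desc.parent T hw hwb
      have huw : u ≠ w := by rintro rfl; exact h1 hw
      obtain ⟨x, _, hx | hx, hx' | hx'⟩ := h.edge_edge u w hr hwr huw z ⟨hz, hzw⟩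
      · exact h1 (hx ▸ hx' ▸ hw)
      · exact h1 (hx ▸ hx' ▸ hwp)
      · exact h2 (hx ▸ hx' ▸ hw)
      · exact h2 (hx ▸ hx' ▸ hwp)
  rw [Set.disjoint_left]
  rintro z hzb (hz | rfl | ⟨w, hw, _, hz⟩)
  · exact key a .refl z hz hzb
  · exact key a .refl _ (node_mem_edgeCurve a) hzb
  · exact key w hw z hz hzb

/-- If the subtree of `a` reaches at least as low as the subtree of its sibling `b`, then the
latter cannot extend over all columns: it would separate the parent from the lowest node of the
former. -/
theorem IsPlanar.not_spanning (h : Γ.IsPlanar) (hup : Γ.IsUpward) {v a b u : Fin n} {lo hi : ℤ}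
    (hcol : Γ.InColumns v lo hi) (ha : a ∈ T.children v) (hb : b ∈ T.children v) (hab : a ≠ b)
    (hu : T.Desc a u) (hlow : ∀ w, T.Desc b w → (Γ.pos u).2 ≤ (Γ.pos w).2)
    (hleft : ∃ z ∈ Γ.treeCurve b, z.1 = lo) (hright : ∃ z ∈ Γ.treeCurve b, z.1 = hi) : False := by
  obtain ⟨S, hS, hd⟩ := hup.exists_path hu
  obtain ⟨har, hav⟩ := T.mem_children.1 ha
  obtain ⟨hbr, hbv⟩ := T.mem_children.1 hb
  have hdv := (hup.edgeCurve har).union hd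
  rw [hav] at hdv
  have hsub : Γ.edgeCurve a ∪ S ⊆ Γ.edgeCurve a ∪ Γ.treeCurve a :=
    Set.union_subset_union_right _ hS
  refine hdv.not_disjoint (hup.isPreconnected_treeCurve b) (a := lo) (b := hi) ?_ ?_ hleft hright
    ((h.disjoint_siblings ha hb hab).mono_right hsub)
  · rintro z (hz | hz)
    · refine hcol.edgeCurve (w := a) (.single ha) ?_ z hz
      rintro rfl
      exact T.not_desc_of_mem_children ha .refl
    · exact (hcol.child ha).treeCurve z (hS hz)
  · intro z hz
    obtain ⟨S', _, w, hw, hzS, hd'⟩ := hup.exists_path_of_mem hz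
    have htop := (hup.edgeCurve hbr).end_le _ (parent_mem_edgeCurve b)
    rw [hbv] at htop
    exact ⟨(hlow w hw).trans (hd'.end_le z hzS), (hd'.le_start z hzS).trans htop⟩

/-- A subtree drawn in the columns from `lo` to `hi` has rooted pathwidth at most
`hi - lo + 1`: if two children both need all of these columns, both touch the outer
columns, and the one that reaches lower is cut off from the parent by the other. -/
theorem IsPlanar.rpwAt_le (h : Γ.IsPlanar) (hup : Γ.IsUpward) (v : Fin n) :
    ∀ lo hi : ℤ, Γ.InColumns v lo hi → (T.rpwAt v : ℤ) ≤ hi - lo + 1 := by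
  induction v using T.wellFounded_depth.induction with
  | _ v ih =>
    intro lo hi hcol
    by_cases hv : (T.children v).Nonempty
    swap
    · rw [T.rpwAt_eq, dif_neg hv]
      obtain ⟨h1, h2⟩ := (hcol v .refl).1
      push_cast
      omega
    obtain ⟨d, hd, hle | ⟨c, hc, hcd, hcd', hle⟩⟩ := T.exists_rpwAt_le hv
    · have := ih d (T.depth_lt_of_mem_children hd) lo hi (hcol.child hd)
      omega
    · by_contra hcon
      have hleft : ∀ a ∈ T.children v, T.rpwAt c ≤ T.rpwAt a →
          ∃ z ∈ Γ.treeCurve a, z.1 = lo := fun a ha hca =>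
        (hcol.child ha).exists_left fun hcol' => by
          have := ih a (T.depth_lt_of_mem_children ha) _ _ hcol'
          omega
      have hright : ∀ a ∈ T.children v, T.rpwAt c ≤ T.rpwAt a →
          ∃ z ∈ Γ.treeCurve a, z.1 = hi := fun a ha hca =>
        (hcol.child ha).exists_right fun hcol' => by
          have := ih a (T.depth_lt_of_mem_children ha) _ _ hcol'
          omega
      classical
      obtain ⟨u, hu, hmin⟩ := Finset.exists_min_image
        (Finset.univ.filter fun u => T.Desc c u ∨ T.Desc d u) (fun u => (Γ.pos u).2)
        ⟨c, by simpa using .inl .refl⟩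
      simp only [Finset.mem_filter, Finset.mem_univ, true_and] at hu hmin
      rcases hu with hu | hu
      · exact h.not_spanning hup hcol hc hd hcd hu (fun w hw => hmin w (.inr hw))
          (hleft d hd hcd') (hright d hd hcd')
      · exact h.not_spanning hup hcol hd hc hcd.symm hu (fun w hw => hmin w (.inl hw))
          (hleft c hc le_rfl) (hright c hc le_rfl)

theorem IsPlanar.rpw_le (h : Γ.IsPlanar) (hup : Γ.IsUpward) {a : ℤ} {W : ℕ}
    (hW : ∀ p ∈ Γ.vertices, 1 ≤ p.1 + a ∧ p.1 + a ≤ W) : T.rpw ≤ W := by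
  have := h.rpwAt_le hup T.root (1 - a) (W - a) fun w hw =>
    ⟨by have := hW _ ⟨w, .inl rfl⟩; constructor <;> omega,
      fun hwr b hb => by have := hW b ⟨w, .inr ⟨hwr, hb⟩⟩; constructor <;> omega⟩
  have h' : (T.rpwAt T.root : ℤ) = T.rpw := rfl
  omega

theorem exists_bound_vertices (Γ : Drawing T) :
    ∃ W : ℕ, ∃ a : ℤ, ∀ p ∈ Γ.vertices, 1 ≤ p.1 + a ∧ p.1 + a ≤ W := by
  have hfin : Γ.vertices.Finite := by
    refine (Set.finite_iUnion fun v => (Γ.pos v :: Γ.bends v).finite_toSet).subset ?_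
    rintro p ⟨v, rfl | ⟨_, hp⟩⟩ <;> simp only [Set.mem_iUnion] <;> use v <;> simp [*]
  obtain ⟨lo, hlo⟩ := (hfin.image Prod.fst).bddBelow
  obtain ⟨hi, hhi⟩ := (hfin.image Prod.fst).bddAbove
  refine ⟨(hi - lo + 1).toNat, 1 - lo, fun p hp => ?_⟩
  have h1 := hlo ⟨p, hp, rfl⟩
  have h2 := hhi ⟨p, hp, rfl⟩
  constructor <;> omega

theorem IsPlanar.rpw_le_width (h : Γ.IsPlanar) (hup : Γ.IsUpward) : T.rpw ≤ Γ.width := by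
  obtain ⟨a, ha⟩ := Nat.sInf_mem Γ.exists_bound_vertices
  exact h.rpw_le hup ha

end Drawing

/-! ### Drawings with one node per row -/

/-- Coordinates `X v`, `Y v` of a drawing in which every subtree occupies the rows from `L v` to
`Y v`, disjoint from those of sibling subtrees. A child is in the column of its parent, and then
its subtree is below those of its siblings, or it is one column to the right. -/
structure Layout {n : ℕ} (T : RTree n) (X Y L : ℕ → ℕ) : Prop where
  le (v : Fin n) : L v ≤ Y v
  nested (c : Fin n) : c ≠ T.root → L (T.parent c) ≤ L c ∧ Y c < Y (T.parent c)
  disjoint (c d : Fin n) : c ≠ T.root → d ≠ T.root → c ≠ d → T.parent c = T.parent d →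
    Y c < L d ∨ Y d < L c
  step (c : Fin n) : c ≠ T.root → X c = X (T.parent c) ∨ X c = X (T.parent c) + 1
  lowest (c d : Fin n) : c ≠ T.root → d ≠ T.root → c ≠ d → T.parent c = T.parent d →
    X c = X (T.parent c) → Y c < L d ∧ X d = X (T.parent d) + 1
  root_X : X T.root = 0
  root_L : L T.root = 0
  root_Y : Y T.root + 1 = n
  lt_rpw (v : Fin n) : X v < T.rpw

namespace Layout

variable {n : ℕ} {T : RTree n} {X Y L : ℕ → ℕ} (h : Layout T X Y L)
include h

theorem desc {v w : Fin n} (hw : T.Desc v w) : L v ≤ L w ∧ Y w ≤ Y v ∧ X v ≤ X w := by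
  induction hw with
  | refl => simp
  | tail _ hc ih =>
    obtain ⟨hr, rfl⟩ := T.mem_children.1 hc
    have h1 := h.nested _ hr
    have h2 := h.step _ hr
    omega

/-- The nodes in the rows of the subtree of `v` belong to that subtree. -/
theorem desc_of_rows (v : Fin n) {w : Fin n} (h1 : L v ≤ Y w) (h2 : Y w ≤ Y v) :
    T.Desc v w := by
  induction v using (measure T.depth).wf.induction with
  | _ v ih =>
    by_cases hv : v = T.root
    · rw [hv]; exact T.desc_root w
    · have hc : v ∈ T.children (T.parent v) := T.mem_children.2 ⟨hv, rfl⟩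
      have hn := h.nested v hv
      have hp := ih (T.parent v) (T.depth_lt_of_mem_children hc) (by omega) (by omega)
      obtain ⟨d, hd, hdw⟩ := RTree.Desc.exists_child T hp (by rintro rfl; omega)
      by_cases hdv : d = v
      · rwa [← hdv]
      · obtain ⟨hdr, hdp⟩ := T.mem_children.1 hd
        have h3 := h.disjoint d v hdr hv hdv hdp
        have h4 := h.desc hdw
        have h5 := h.le w
        omega

theorem eq_of_Y_eq {v w : Fin n} (hvw : Y v = Y w) : v = w := by
  have hd := h.desc_of_rows v (w := w) (by have := h.le v; omega) hvw.ge
  by_contra hne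
  obtain ⟨hr, hp⟩ := RTree.Desc.parent T hd (Ne.symm hne)
  have h1 := h.nested w hr
  have h2 := h.desc hp
  omega

/-- No node in the column of the parent of `c` lies in a row strictly between the two. -/
theorem Y_le {c w : Fin n} (hc : c ≠ T.root) (hX : X w = X (T.parent c))
    (hY : Y w < Y (T.parent c)) : Y w ≤ Y c := by
  have hn := h.nested c hc
  have hle := h.le c
  by_cases hL : Y w < L (T.parent c)
  · omega
  · have hd := h.desc_of_rows (T.parent c) (not_lt.1 hL) hY.le
    obtain ⟨d, hd, hdw⟩ := RTree.Desc.exists_child T hd (by rintro rfl; omega)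
    obtain ⟨hdr, hdp⟩ := T.mem_children.1 hd
    have h4 := h.desc hdw
    by_cases hdc : d = c
    · subst hdc; omega
    · have h5 := h.step d hdr
      rw [hdp] at h5
      have h6 := h.lowest d c hdr hc hdc hdp (by rw [hdp]; omega)
      omega

theorem Y_lt (v : Fin n) : Y v < n := by
  have h1 := h.desc (T.desc_root v)
  have h2 := h.root_Y
  omega

omit h in
theorem edgePoints (v : Fin n) : (straightDrawing T X Y).edgePoints v =
    [((X (T.parent v) : ℤ), (Y (T.parent v) : ℝ)), ((X v : ℤ), (Y v : ℝ))] := rfl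

omit h in
theorem edgeCurve (v : Fin n) : (straightDrawing T X Y).edgeCurve v =
    segment ℝ ((X (T.parent v) : ℝ), (Y (T.parent v) : ℝ)) ((X v : ℝ), (Y v : ℝ)) := by
  have : (straightDrawing T X Y).edgeCurve v =
      segment ℝ (toPlane ((X (T.parent v) : ℤ), (Y (T.parent v) : ℝ)))
        (toPlane ((X v : ℤ), (Y v : ℝ))) ∪ {toPlane ((X v : ℤ), (Y v : ℝ))} := rfl
  rw [this, Set.union_eq_left.2 (by simpa using right_mem_segment ℝ _ _)]
  simp [toPlane]

omit h in
theorem toPlane_pos (v : Fin n) :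
    toPlane ((straightDrawing T X Y).pos v) = ((X v : ℝ), (Y v : ℝ)) := by
  simp [toPlane, straightDrawing]

omit h in
theorem mem_edgeCurve {v : Fin n} {z : ℝ × ℝ} (hz : z ∈ (straightDrawing T X Y).edgeCurve v) :
    ∃ t : ℝ, 0 ≤ t ∧ t ≤ 1 ∧ z.1 = (X (T.parent v) : ℝ) + t * (X v - X (T.parent v)) ∧
      z.2 = (Y (T.parent v) : ℝ) + t * (Y v - Y (T.parent v)) := by
  rw [edgeCurve, segment_eq_image'] at hz
  obtain ⟨t, ⟨h0, h1⟩, rfl⟩ := hz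
  exact ⟨t, h0, h1, by simp, by simp⟩

theorem isStrictlyUpward : (straightDrawing T X Y).IsStrictlyUpward := by
  intro v hv
  have := (h.nested v hv).2
  simpa [edgePoints] using this

theorem node_edge {v w : Fin n} (hv : v ≠ T.root)
    (hw : toPlane ((straightDrawing T X Y).pos w) ∈ (straightDrawing T X Y).edgeCurve v) :
    w = v ∨ w = T.parent v := by
  obtain ⟨t, h0, h1, hx, hy⟩ := mem_edgeCurve hw
  rw [toPlane_pos] at hx hy
  simp only at hx hy
  have hn := (h.nested v hv).2
  have hn' : (Y v : ℝ) + 1 ≤ Y (T.parent v) := by exact_mod_cast hn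
  rcases h.step v hv with hs | hs
  · have hX : X w = X (T.parent v) := by
      rw [hs] at hx
      simpa using hx
    have hY1 : Y w ≤ Y (T.parent v) := by
      have : (Y w : ℝ) ≤ Y (T.parent v) := by nlinarith
      exact_mod_cast this
    have hY2 : Y v ≤ Y w := by
      have : (Y v : ℝ) ≤ Y w := by nlinarith
      exact_mod_cast this
    rcases hY1.eq_or_lt with he | hlt
    · exact .inr (h.eq_of_Y_eq he)
    · exact .inl (h.eq_of_Y_eq (le_antisymm (h.Y_le hv hX hlt) hY2))
  · -- On a slanted edge, only the ends have integral `x`-coordinate.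
    rw [hs] at hx
    push_cast at hx
    have hx1 : (X w : ℝ) = X (T.parent v) + t := by linarith
    have hcase : X w = X (T.parent v) ∨ X w = X (T.parent v) + 1 := by
      have h2 : (X (T.parent v) : ℝ) ≤ X w := by linarith
      have h3 : (X w : ℝ) ≤ ((X (T.parent v) + 1 : ℕ) : ℝ) := by push_cast; linarith
      have h2' : X (T.parent v) ≤ X w := by exact_mod_cast h2
      have h3' : X w ≤ X (T.parent v) + 1 := by exact_mod_cast h3
      omega
    rcases hcase with hX | hX
    · have ht : t = 0 := by rw [hX] at hx1; linarith
      subst ht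
      right
      apply h.eq_of_Y_eq
      have : (Y w : ℝ) = Y (T.parent v) := by linarith
      exact_mod_cast this
    · have ht : t = 1 := by rw [hX] at hx1; push_cast at hx1; linarith
      subst ht
      left
      apply h.eq_of_Y_eq
      have : (Y w : ℝ) = Y v := by linarith
      exact_mod_cast this

/-- Two edges meet only in common ends, if the upper end of the second is not above that of the
first. -/
theorem edge_edge_aux {v w : Fin n} (hv : v ≠ T.root) (hw : w ≠ T.root) (hvw : v ≠ w)
    (hle : Y (T.parent w) ≤ Y (T.parent v)) {z : ℝ × ℝ}
    (hzv : z ∈ (straightDrawing T X Y).edgeCurve v)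
    (hzw : z ∈ (straightDrawing T X Y).edgeCurve w) :
    ∃ u, z = toPlane ((straightDrawing T X Y).pos u) ∧ (u = v ∨ u = T.parent v) ∧
      (u = w ∨ u = T.parent w) := by
  -- It suffices that `z` is the position of some node.
  suffices hu : ∃ u, z = toPlane ((straightDrawing T X Y).pos u) by
    obtain ⟨u, rfl⟩ := hu
    exact ⟨u, rfl, h.node_edge hv hzv, h.node_edge hw hzw⟩
  obtain ⟨t, ht0, ht1, hx, hy⟩ := mem_edgeCurve hzv
  obtain ⟨s, hs0, hs1, hx', hy'⟩ := mem_edgeCurve hzw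
  have hnv : (Y v : ℝ) + 1 ≤ Y (T.parent v) := by exact_mod_cast (h.nested v hv).2
  have hnw : (Y w : ℝ) + 1 ≤ Y (T.parent w) := by exact_mod_cast (h.nested w hw).2
  have hle' : (Y (T.parent w) : ℝ) ≤ Y (T.parent v) := by exact_mod_cast hle
  have of_eq : ∀ u : Fin n, z.1 = X u → z.2 = Y u →
      ∃ u, z = toPlane ((straightDrawing T X Y).pos u) := fun u h1 h2 =>
    ⟨u, by rw [toPlane_pos]; exact Prod.ext h1 h2⟩
  by_cases ht0' : t = 0
  · subst ht0'; exact of_eq (T.parent v) (by linarith) (by linarith)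
  by_cases ht1' : t = 1
  · subst ht1'; exact of_eq v (by linarith) (by linarith)
  by_cases hs0' : s = 0
  · subst hs0'; exact of_eq (T.parent w) (by linarith) (by linarith)
  by_cases hs1' : s = 1
  · subst hs1'; exact of_eq w (by linarith) (by linarith)
  replace ht0 := lt_of_le_of_ne ht0 (Ne.symm ht0')
  replace ht1 := lt_of_le_of_ne ht1 ht1'
  replace hs0 := lt_of_le_of_ne hs0 (Ne.symm hs0')
  replace hs1 := lt_of_le_of_ne hs1 hs1'
  have lt_of : ∀ a b : ℕ, (a : ℝ) < b + 1 → a ≤ b := fun a b hab => by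
    have : (a : ℝ) < ((b + 1 : ℕ) : ℝ) := by push_cast; exact hab
    exact Nat.lt_succ_iff.1 (by exact_mod_cast this)
  rcases h.step v hv with hXv | hXv <;> rcases h.step w hw with hXw | hXw <;>
    rw [hXv] at hx <;> rw [hXw] at hx' <;> push_cast at hx hx'
  · have hX : X (T.parent w) = X (T.parent v) := by
      have : (X (T.parent w) : ℝ) = X (T.parent v) := by linarith
      exact_mod_cast this
    by_cases hp : T.parent v = T.parent w
    · have := (h.lowest v w hv hw hvw hp hXv).2
      omega
    · have hlt : Y (T.parent w) < Y (T.parent v) :=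
        lt_of_le_of_ne hle fun he => hp (h.eq_of_Y_eq he).symm
      have h1 : (Y (T.parent w) : ℝ) ≤ Y v := by exact_mod_cast h.Y_le hv hX hlt
      nlinarith
  · have h1 := lt_of (X (T.parent v)) (X (T.parent w)) (by linarith)
    have h2 := lt_of (X (T.parent w) + 1) (X (T.parent v)) (by push_cast; linarith)
    omega
  · have h1 := lt_of (X (T.parent w)) (X (T.parent v)) (by linarith)
    have h2 := lt_of (X (T.parent v) + 1) (X (T.parent w)) (by push_cast; linarith)
    omega
  · have h1 := lt_of (X (T.parent v)) (X (T.parent w)) (by linarith)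
    have h2 := lt_of (X (T.parent w)) (X (T.parent v)) (by linarith)
    have hX : X (T.parent w) = X (T.parent v) := by omega
    have hts : t = s := by rw [hX] at hx'; linarith
    subst hts
    by_cases hp : T.parent v = T.parent w
    · exfalso
      rw [hp] at hy
      have h3 : t * (Y v : ℝ) = t * Y w := by linarith
      have h4 : (Y v : ℝ) = Y w := mul_left_cancel₀ ht0' h3
      exact hvw (h.eq_of_Y_eq (by exact_mod_cast h4))
    · have hlt : Y (T.parent w) < Y (T.parent v) :=
        lt_of_le_of_ne hle fun he => hp (h.eq_of_Y_eq he).symm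
      have h3 : (Y (T.parent w) : ℝ) ≤ Y v := by exact_mod_cast h.Y_le hv hX hlt
      nlinarith

theorem isPlanar : (straightDrawing T X Y).IsPlanar where
  pos_injective v w hvw := by
    have h2 : (Y v : ℝ) = Y w := congrArg Prod.snd hvw
    exact h.eq_of_Y_eq (by exact_mod_cast h2)
  simple v hv := by
    refine ⟨fun he => ?_, fun z hz => hz.2, trivial⟩
    have h1 : (Y (T.parent v) : ℝ) = Y v := congrArg Prod.snd he
    have h2 := (h.nested v hv).2
    have h3 : Y (T.parent v) = Y v := by exact_mod_cast h1
    omega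
  node_edge v w hv hw := h.node_edge hv hw
  edge_edge v w hv hw hvw z hz := by
    rcases le_total (Y (T.parent w)) (Y (T.parent v)) with hle | hle
    · exact h.edge_edge_aux hv hw hvw hle hz.1 hz.2
    · obtain ⟨u, h1, h2, h3⟩ := h.edge_edge_aux hw hv hvw.symm hle hz.2 hz.1
      exact ⟨u, h1, h3, h2⟩

omit h in
theorem mem_vertices {p : ℤ × ℝ} (hp : p ∈ (straightDrawing T X Y).vertices) :
    ∃ v : Fin n, p = ((X v : ℤ), (Y v : ℝ)) := by
  obtain ⟨v, rfl | ⟨_, hv⟩⟩ := hp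
  · exact ⟨v, rfl⟩
  · exact absurd hv List.not_mem_nil

theorem width_eq : (straightDrawing T X Y).width = T.rpw := by
  refine le_antisymm (Nat.sInf_le ⟨1, fun p hp => ?_⟩) (h.isPlanar.rpw_le_width
    fun v hv => (h.isStrictlyUpward v hv).imp le_of_lt)
  obtain ⟨v, rfl⟩ := mem_vertices hp
  have := h.lt_rpw v
  simp only
  omega

theorem height_eq : (straightDrawing T X Y).height = n := by
  have hset : {j : ℤ | ∃ p ∈ (straightDrawing T X Y).support, p.2 = j} =
      ((Finset.univ.image fun v : Fin n => (Y v : ℤ) : Finset ℤ) : Set ℤ) := by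
    -- The rows of the nodes are `n` distinct numbers below `n`, hence all of them.
    have hsurj : ∀ j < n, ∃ v : Fin n, Y v = j := by
      intro j hj
      have hinj : Function.Injective fun v : Fin n => (⟨Y v, h.Y_lt v⟩ : Fin n) :=
        fun v w hvw => h.eq_of_Y_eq (Fin.mk.inj_iff.1 hvw)
      obtain ⟨v, hv⟩ := (Finite.injective_iff_surjective.1 hinj) ⟨j, hj⟩
      exact ⟨v, Fin.mk.inj_iff.1 hv⟩
    ext j
    simp only [Set.mem_ofPred_eq, Finset.coe_image, Finset.coe_univ, Set.image_univ,
      Set.mem_range]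
    constructor
    · rintro ⟨p, ⟨v, hp⟩, hj⟩
      have hbound : 0 ≤ p.2 ∧ p.2 < n := by
        have h1 : (Y v : ℝ) < n := by exact_mod_cast h.Y_lt v
        have h2 : (Y (T.parent v) : ℝ) < n := by exact_mod_cast h.Y_lt (T.parent v)
        have h3 : (0 : ℝ) ≤ Y v := Nat.cast_nonneg _
        have h4 : (0 : ℝ) ≤ Y (T.parent v) := Nat.cast_nonneg _
        rcases hp with rfl | ⟨hv, hp⟩
        · rw [toPlane_pos]; exact ⟨h3, h1⟩
        · obtain ⟨t, h5, h6, _, h7⟩ := mem_edgeCurve hp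
          have h8 : (Y v : ℝ) ≤ Y (T.parent v) := by exact_mod_cast (h.nested v hv).2.le
          rw [h7]
          constructor <;> nlinarith
      rw [hj] at hbound
      have h1 : 0 ≤ j := by exact_mod_cast hbound.1
      have h2 : j < n := by exact_mod_cast hbound.2
      lift j to ℕ using h1
      obtain ⟨w, hw⟩ := hsurj j (by exact_mod_cast h2)
      exact ⟨w, by exact_mod_cast hw⟩
    · rintro ⟨v, rfl⟩
      exact ⟨_, ⟨v, .inl rfl⟩, by rw [toPlane_pos]; simp⟩
  rw [Drawing.height, hset, Set.ncard_coe_finset, Finset.card_image_of_injective, Finset.card_univ,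
    Fintype.card_fin]
  intro v w hvw
  exact h.eq_of_Y_eq (Nat.cast_injective hvw)

omit h in
theorem isGrid : (straightDrawing T X Y).IsGrid := by
  intro p hp
  obtain ⟨v, rfl⟩ := mem_vertices hp
  exact ⟨Y v, by simp⟩

theorem rootTopLeft : (straightDrawing T X Y).RootTopLeft := by
  intro p hp
  obtain ⟨v, rfl⟩ := mem_vertices hp
  have h1 := h.desc (T.desc_root v)
  exact ⟨by simpa [straightDrawing] using h1.2.2, by simpa [straightDrawing] using h1.2.1⟩

end Layout

/-! ### Running programs -/

@[simp] theorem Memory.var_setVar (s : Memory) (x k y : ℕ) :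
    (s.setVar x k).var y = if y = x then k else s.var y := by
  simp [Memory.setVar, Function.update_apply]

@[simp] theorem Memory.arr_setVar (s : Memory) (x k : ℕ) : (s.setVar x k).arr = s.arr := rfl

@[simp] theorem Memory.var_setArr (s : Memory) (a i k : ℕ) : (s.setArr a i k).var = s.var := rfl

@[simp] theorem Memory.arr_setArr (s : Memory) (a i k b : ℕ) :
    (s.setArr a i k).arr b = if b = a then Function.update (s.arr b) i k else s.arr b := by
  by_cases h : b = a
  · subst h; simp [Memory.setArr]
  · simp [Memory.setArr, h]

namespace Program

/-- The weakest precondition under which a loop-free program halts in a memory that satisfies `Q`,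
having written only values and addresses that are at most `B`. -/
def wp (B : ℕ) : Program → (Memory → Prop) → Memory → Prop
  | skip, Q, s => Q s
  | assign x e, Q, s => e.eval s ≤ B ∧ Q (s.setVar x (e.eval s))
  | store a i e, Q, s => i.eval s ≤ B ∧ e.eval s ≤ B ∧ Q (s.setArr a (i.eval s) (e.eval s))
  | seq P P', Q, s => P.wp B (P'.wp B Q) s
  | branch e P P', Q, s => (e.eval s ≠ 0 → P.wp B Q s) ∧ (e.eval s = 0 → P'.wp B Q s)
  | loop _ _, _, _ => False

/-- An upper bound for the number of steps of a loop-free program. -/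
def maxTime : Program → ℕ
  | skip => 1
  | assign _ e => e.cost + 1
  | store _ i e => i.cost + e.cost + 1
  | seq P P' => P.maxTime + P'.maxTime
  | branch e P P' => e.cost + 1 + max P.maxTime P'.maxTime
  | loop _ _ => 0

/-- Started with memory `s`, the program halts within `k` steps in a memory that satisfies `Q`,
having written only values and addresses that are at most `B`. -/
def Runs (B : ℕ) (P : Program) (s : Memory) (k : ℕ) (Q : Memory → Prop) : Prop :=
  ∃ t s', Exec B P s t s' ∧ t ≤ k ∧ Q s'

theorem Runs.of_wp {B : ℕ} {P : Program} {Q : Memory → Prop} {s : Memory} (h : P.wp B Q s) :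
    Runs B P s P.maxTime Q := by
  induction P generalizing Q s with
  | skip => exact ⟨_, _, .skip s, le_rfl, h⟩
  | assign x e => exact ⟨_, _, .assign x e s h.1, le_rfl, h.2⟩
  | store a i e => exact ⟨_, _, .store a i e s h.1 h.2.1, le_rfl, h.2.2⟩
  | seq P P' ih ih' =>
    obtain ⟨t, s', h1, h2, h3⟩ := ih h
    obtain ⟨t', s'', h1', h2', h3'⟩ := ih' h3
    exact ⟨_, _, h1.seq h1', add_le_add h2 h2', h3'⟩
  | branch e P P' ih ih' =>
    by_cases he : e.eval s = 0
    · obtain ⟨t, s', h1, h2, h3⟩ := ih' (h.2 he)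
      exact ⟨_, _, .branch_false he h1,
        Nat.add_le_add_left (h2.trans (le_max_right _ _)) _, h3⟩
    · obtain ⟨t, s', h1, h2, h3⟩ := ih (h.1 he)
      exact ⟨_, _, .branch_true he h1,
        Nat.add_le_add_left (h2.trans (le_max_left _ _)) _, h3⟩
  | loop e P => exact h.elim

theorem wp_mono {B : ℕ} {P : Program} {Q Q' : Memory → Prop} (hQ : ∀ s, Q s → Q' s) {s : Memory}
    (h : P.wp B Q s) : P.wp B Q' s := by
  induction P generalizing Q Q' s with
  | skip => exact hQ _ h
  | assign x e => exact ⟨h.1, hQ _ h.2⟩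
  | store a i e => exact ⟨h.1, h.2.1, hQ _ h.2.2⟩
  | seq P P' ih ih' => exact ih (fun _ => ih' hQ) h
  | branch e P P' ih ih' => exact ⟨fun he => ih hQ (h.1 he), fun he => ih' hQ (h.2 he)⟩
  | loop e P => exact h.elim

theorem Runs.seq {B k k' : ℕ} {P P' : Program} {s : Memory} {Q Q' : Memory → Prop}
    (h : Runs B P s k Q) (h' : ∀ s', Q s' → Runs B P' s' k' Q') :
    Runs B (.seq P P') s (k + k') Q' := by
  obtain ⟨t, s', h1, h2, h3⟩ := h
  obtain ⟨t', s'', h1', h2', h3'⟩ := h' s' h3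
  exact ⟨_, _, h1.seq h1', add_le_add h2 h2', h3'⟩

/-- The rule for loops with a loop-free body and a known number `m` of iterations. -/
theorem Runs.loop {B m : ℕ} {e : Expr} {P : Program} (I : ℕ → Memory → Prop)
    (hstep : ∀ i < m, ∀ s, I i s → e.eval s ≠ 0 ∧ P.wp B (I (i + 1)) s)
    (hend : ∀ s, I m s → e.eval s = 0) {s : Memory} (hs : I 0 s) :
    Runs B (.loop e P) s ((e.cost + 1 + P.maxTime) * m + (e.cost + 1)) (I m) := by
  suffices H : ∀ j i s, i + j = m → I i s →
      Runs B (.loop e P) s ((e.cost + 1 + P.maxTime) * j + (e.cost + 1)) (I m) from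
    H m 0 s (Nat.zero_add m) hs
  intro j
  induction j with
  | zero =>
    rintro i s rfl hi
    exact ⟨_, _, .loop_false (hend s hi), by omega, hi⟩
  | succ j ih =>
    rintro i s hij hi
    obtain ⟨he, hP⟩ := hstep i (by omega) s hi
    obtain ⟨t, s', h1, h2, h3⟩ := Runs.of_wp hP
    obtain ⟨t', s'', h1', h2', h3'⟩ := ih (i + 1) s' (by omega) h3
    refine ⟨_, _, .loop_true he h1 h1', ?_, h3'⟩
    rw [Nat.mul_succ]
    omega

end Program

/-! ### The algorithm

Variables: `0` number of nodes, `1` root, `2` loop counter, `3` length of the queue, `4` current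
node `v`, `5` its parent `p`, `6` the heavy child of `p`.

Arrays: `0` parent, `1` column, `2` row, `3` number of pending children, `4` queue, `5` number of
proper descendants, `6` lower bound for the rooted pathwidth, minus one, `7` largest lower
bound among the children, `8` heavy child, `9` offset among the siblings, `10` lowest row
of the subtree. -/

/-- One round of `countLoop`: counts the node with the number in variable `2` at its parent. -/
def countBody : Program :=
  .seq (.store 3 (.get 0 (.var 2)) (.add (.get 3 (.get 0 (.var 2))) (.const 1)))
    (.assign 2 (.add (.var 2) (.const 1)))

/-- Counts, in array `3`, the nodes with a given parent. The root, being its own parent, counts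
itself, so that its count never drops to zero and it never enters the queue. -/
def countLoop : Program :=
  .loop (.lt (.var 2) (.var 0)) countBody

/-- One round of `leafLoop`: appends the node with the number in variable `2` to the queue if it
is a leaf. -/
def leafBody : Program :=
  .seq (.branch (.get 3 (.var 2)) .skip
    (.seq (.store 4 (.var 3) (.var 2)) (.assign 3 (.add (.var 3) (.const 1)))))
    (.assign 2 (.add (.var 2) (.const 1)))

/-- Puts the leaves into the queue. -/
def leafLoop : Program :=
  .loop (.lt (.var 2) (.var 0)) leafBody

/-- Updates the data of the node in variable `5` by those of its child in variable `4`. If the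
bound of the child is larger than those of its siblings treated before, it becomes the heavy child
and its bound that of the parent; otherwise the bound of the parent is raised, if necessary, to one
more than that of the child. -/
def absorb : Program :=
  .seq (.store 9 (.var 4) (.get 5 (.var 5))) <|
  .seq (.store 5 (.var 5) (.add (.add (.get 5 (.var 5)) (.get 5 (.var 4))) (.const 1)))
    (.branch (.lt (.get 6 (.var 4)) (.get 7 (.var 5)))
      (.branch (.lt (.get 6 (.var 5)) (.add (.get 6 (.var 4)) (.const 1)))
        (.store 6 (.var 5) (.add (.get 6 (.var 4)) (.const 1)))
        .skip)
      (.seq (.store 6 (.var 5) (.get 6 (.var 4))) <|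
        .seq (.store 7 (.var 5) (.add (.get 6 (.var 4)) (.const 1)))
          (.store 8 (.var 5) (.var 4))))

/-- One round of `upLoop`: takes the next node from the queue, hands its data to its parent, and
appends the parent to the queue if this was the last of its children. -/
def upBody : Program :=
  .seq (.assign 4 (.get 4 (.var 2))) <|
  .seq (.assign 5 (.get 0 (.var 4))) <|
  .seq absorb <|
  .seq (.store 3 (.var 5) (.sub (.get 3 (.var 5)) (.const 1))) <|
  .seq (.branch (.get 3 (.var 5)) .skip
    (.seq (.store 4 (.var 3) (.var 5)) (.assign 3 (.add (.var 3) (.const 1)))))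
    (.assign 2 (.add (.var 2) (.const 1)))

/-- Treats all nodes other than the root, children before parents. -/
def upLoop : Program :=
  .loop (.lt (.add (.var 2) (.const 1)) (.var 0)) upBody

/-- One round of `downLoop`: places a node relative to its parent. The heavy child stays in the
column of the parent, at the lowest rows; the siblings with a smaller offset are moved up by the
size of its subtree. -/
def downBody : Program :=
  .seq (.assign 2 (.sub (.var 2) (.const 1))) <|
  .seq (.assign 4 (.get 4 (.var 2))) <|
  .seq (.assign 5 (.get 0 (.var 4))) <|
  .seq (.assign 6 (.get 8 (.var 5))) <|
  .seq (.branch (.eq (.var 4) (.var 6))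
    (.seq (.store 1 (.var 4) (.get 1 (.var 5))) (.store 10 (.var 4) (.get 10 (.var 5))))
    (.seq (.store 1 (.var 4) (.add (.get 1 (.var 5)) (.const 1)))
      (.branch (.lt (.get 9 (.var 4)) (.get 9 (.var 6)))
        (.store 10 (.var 4) (.add (.get 10 (.var 5))
          (.add (.get 9 (.var 4)) (.add (.get 5 (.var 6)) (.const 1)))))
        (.store 10 (.var 4) (.add (.get 10 (.var 5)) (.get 9 (.var 4)))))))
    (.store 2 (.var 4) (.add (.get 10 (.var 4)) (.get 5 (.var 4))))

/-- Treats the nodes in reverse order of the queue, hence parents before children. -/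
def downLoop : Program :=
  .loop (.lt (.const 0) (.var 2)) downBody

/-- The linear-time drawing algorithm. The root gets the top row; its column and the lowest row of
its subtree are zero from the start. -/
def drawTree : Program :=
  .seq countLoop <|
  .seq (.assign 2 (.const 0)) <|
  .seq leafLoop <|
  .seq (.assign 2 (.const 0)) <|
  .seq upLoop <|
  .seq (.store 2 (.var 1) (.get 5 (.var 1)))
    downLoop

namespace RTree

variable {n : ℕ} (T : RTree n)

/-- The number of nodes in `D` with parent `v`. -/
def pending (D : Finset (Fin n)) (v : Fin n) : ℕ := (D.filter fun c => T.parent c = v).card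

theorem pending_insert {D : Finset (Fin n)} {c : Fin n} (hc : c ∉ D) (v : Fin n) :
    T.pending (insert c D) v = T.pending D v + if v = T.parent c then 1 else 0 := by
  unfold pending
  rw [Finset.filter_insert]
  by_cases h : T.parent c = v
  · rw [if_pos h, Finset.card_insert_of_notMem (by simp [hc]), if_pos h.symm]
  · rw [if_neg h, if_neg (Ne.symm h), add_zero]

theorem pending_le (D : Finset (Fin n)) (v : Fin n) : T.pending D v ≤ n := by
  simpa [pending] using Finset.card_le_univ (D.filter fun c => T.parent c = v)

theorem pending_eq_zero {D : Finset (Fin n)} {v : Fin n} :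
    T.pending D v = 0 ↔ ∀ c, T.parent c = v → c ∉ D := by
  rw [pending, Finset.card_eq_zero, Finset.filter_eq_empty_iff]
  exact ⟨fun h c hc hD => h hD hc, fun h c hD hc => h c hc hD⟩

/-- In a set of nodes that contains the root and is not reduced to it, some node other than the
root is not the parent of any node of the set. -/
theorem exists_pending_eq_zero {D : Finset (Fin n)} (hD : ∃ v ∈ D, v ≠ T.root) :
    ∃ v ∈ D, v ≠ T.root ∧ T.pending D v = 0 := by
  obtain ⟨v, hv, hmax⟩ := Finset.exists_max_image (D.filter (· ≠ T.root)) T.depth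
    (by obtain ⟨v, hv⟩ := hD; exact ⟨v, by simpa using hv⟩)
  simp only [Finset.mem_filter] at hv hmax
  refine ⟨v, hv.1, hv.2, T.pending_eq_zero.2 fun c hc hcD => ?_⟩
  have hcr : c ≠ T.root := by
    rintro rfl
    exact hv.2 (by rw [← hc, T.parent_root])
  exact (hmax c ⟨hcD, hcr⟩).not_gt (T.depth_lt_of_mem_children (T.mem_children.2 ⟨hcr, hc⟩))

/-! ### The queue -/

/-- The first `t` entries of `ord` enumerate the nodes that are `ready`, each after all nodes of
which it is the parent. -/
structure Queue (ready : Fin n → Prop) (t : ℕ) (ord : ℕ → ℕ) : Prop where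
  node (j : ℕ) : j < t → ∃ v : Fin n, ord j = v
  inj (j k : ℕ) : j < t → k < t → ord j = ord k → j = k
  mem_iff (v : Fin n) : (∃ j < t, ord j = v) ↔ ready v
  before (k : ℕ) (c : Fin n) : k < t → ord k = T.parent c → ∃ j < k, ord j = c

namespace Queue

variable {T} {ready ready' : Fin n → Prop} {t : ℕ} {ord : ℕ → ℕ}

theorem congr (h : T.Queue ready t ord) (h' : ∀ u, ready' u ↔ ready u) : T.Queue ready' t ord :=
  ⟨h.node, h.inj, fun v => (h.mem_iff v).trans (h' v).symm, h.before⟩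

theorem length_le (h : T.Queue ready t ord) : t ≤ n := by
  choose f hf using fun j : Fin t => h.node j j.2
  have hinj : Function.Injective f := fun j k hjk =>
    Fin.ext (h.inj j k j.2 k.2 (by rw [hf, hf, hjk]))
  simpa using Fintype.card_le_of_injective f hinj

/-- A node may be appended once all nodes of which it is the parent are ready. -/
theorem push (h : T.Queue ready t ord) {v : Fin n} (hv : ¬ ready v)
    (hc : ∀ c, T.parent c = v → ready c) (h' : ∀ u, ready' u ↔ ready u ∨ u = v) :
    T.Queue ready' (t + 1) (Function.update ord t v) := by
  have hlt : ∀ j < t, Function.update ord t v j = ord j := fun j hj =>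
    Function.update_of_ne hj.ne _ _
  have hnew : ∀ j < t, ord j ≠ v := fun j hj he => hv ((h.mem_iff v).1 ⟨j, hj, he⟩)
  refine ⟨fun j hj => ?_, fun j k hj hk hjk => ?_, fun u => ?_, fun k c hk hkc => ?_⟩
  · rcases Nat.lt_succ_iff_lt_or_eq.1 hj with hj | rfl
    · rw [hlt j hj]; exact h.node j hj
    · exact ⟨v, by simp⟩
  · rcases Nat.lt_succ_iff_lt_or_eq.1 hj with hj | rfl <;>
      rcases Nat.lt_succ_iff_lt_or_eq.1 hk with hk | rfl
    · rw [hlt j hj, hlt k hk] at hjk; exact h.inj j k hj hk hjk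
    · rw [hlt j hj, Function.update_self] at hjk; exact absurd hjk (hnew j hj)
    · rw [hlt k hk, Function.update_self] at hjk; exact absurd hjk.symm (hnew k hk)
    · rfl
  · rw [h', ← h.mem_iff]
    constructor
    · rintro ⟨j, hj, hju⟩
      rcases Nat.lt_succ_iff_lt_or_eq.1 hj with hj | rfl
      · exact .inl ⟨j, hj, by rwa [hlt j hj] at hju⟩
      · rw [Function.update_self] at hju
        exact .inr (Fin.ext hju.symm)
    · rintro (⟨j, hj, hju⟩ | rfl)
      · exact ⟨j, by omega, by rwa [hlt j hj]⟩
      · exact ⟨t, by omega, by simp⟩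
  · have key : ∀ k ≤ t, (∃ j < k, ord j = c) → ∃ j < k, Function.update ord t v j = c := by
      rintro k hk ⟨j, hj, hjc⟩
      exact ⟨j, hj, by rwa [hlt j (by omega)]⟩
    rcases Nat.lt_succ_iff_lt_or_eq.1 hk with hk | rfl
    · rw [hlt k hk] at hkc
      exact key k hk.le (h.before k c hk hkc)
    · rw [Function.update_self] at hkc
      exact key k le_rfl ((h.mem_iff c).2 (hc c (Fin.ext hkc.symm)))

/-- The root, being its own parent, would have to precede itself in the queue. -/
theorem ne_root (h : T.Queue ready t ord) {j : ℕ} (hj : j < t) : ord j ≠ T.root := by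
  intro hr
  obtain ⟨k, hk, hkr⟩ := h.before j T.root hj (by rw [hr, T.parent_root])
  have := h.inj j k hj (by omega) (hr.trans hkr.symm)
  omega

end Queue

/-! ### The data collected from the leaves upwards -/

/-- The relations between the data of the nodes after the nodes in `H` have been treated. For `c` in
`H`, the number `sz c` of proper descendants is final, and `r c + 1` is the bound for its rooted
pathwidth. The treated children of `p` occupy disjoint intervals of `sz c + 1` numbers, starting at
`off c`, below `sz p`. A `best p` of zero means that no child of `p` has been treated; otherwise
`heavy p` is a treated child of `p` and `best p` is `r (heavy p) + 1`. -/
structure Collected (H : Finset (Fin n)) (sz r best heavy off : ℕ → ℕ) : Prop where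
  sum : ∑ v ∈ Hᶜ, (sz v + 1) = n
  r_le (v : Fin n) : r v ≤ sz v
  r_lt (v : Fin n) : r v + 1 ≤ T.rpwAt v
  nested (c : Fin n) : c ∈ H → off c + sz c + 1 ≤ sz (T.parent c)
  disjoint (c d : Fin n) : c ∈ H → d ∈ H → c ≠ d → T.parent c = T.parent d →
    off c + sz c + 1 ≤ off d ∨ off d + sz d + 1 ≤ off c
  child (c : Fin n) : c ∈ H → r c ≤ r (T.parent c) ∧ r c + 1 ≤ best (T.parent c) ∧
    (heavy (T.parent c) ≠ c → r c + 1 ≤ r (T.parent c))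
  best_eq (p : Fin n) : best p = 0 ∨
    ∃ h : Fin n, h ∈ H ∧ heavy p = h ∧ T.parent h = p ∧ best p = r h + 1

namespace Collected

variable {T} {H : Finset (Fin n)} {sz r best heavy off : ℕ → ℕ}

theorem init : T.Collected ∅ (fun _ => 0) (fun _ => 0) (fun _ => 0) (fun _ => 0) (fun _ => 0) where
  sum := by simp
  r_le _ := le_rfl
  r_lt v := T.one_le_rpwAt v
  nested _ h := by simp at h
  disjoint _ _ h := by simp at h
  child _ h := by simp at h
  best_eq _ := .inl rfl

/-- The sizes of two untreated nodes fit into the invariant sum; this bounds the values that the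
program writes. -/
theorem sz_add_sz (h : T.Collected H sz r best heavy off) {v p : Fin n} (hv : v ∉ H) (hp : p ∉ H)
    (hvp : v ≠ p) : sz v + sz p + 2 ≤ n := by
  have := Finset.sum_le_sum_of_subset (f := fun v : Fin n => sz v + 1) (s := {v, p}) (t := Hᶜ)
    (by intro x; simp only [Finset.mem_insert, Finset.mem_singleton, Finset.mem_compl]
        rintro (rfl | rfl) <;> assumption)
  rw [Finset.sum_pair hvp, h.sum] at this
  omega

/-- The sum over the untreated nodes is unchanged, as the term of the treated node moves to its
parent. -/
theorem sum_insert (h : ∑ v ∈ Hᶜ, (sz v + 1) = n) {v p : Fin n} (hv : v ∉ H) (hp : p ∉ H)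
    (hvp : v ≠ p) :
    ∑ u ∈ (insert v H)ᶜ, (Function.update sz p (sz p + sz v + 1) u + 1) = n := by
  have hv' : v ∈ Hᶜ := Finset.mem_compl.2 hv
  have hp' : p ∈ Hᶜ.erase v := Finset.mem_erase.2 ⟨hvp.symm, Finset.mem_compl.2 hp⟩
  rw [← Finset.add_sum_erase _ _ hv', ← Finset.add_sum_erase _ _ hp'] at h
  rw [Finset.compl_insert, ← Finset.add_sum_erase _ _ hp']
  rw [Finset.sum_congr rfl (g := fun u : Fin n => sz u + 1), Function.update_self]
  · omega
  · intro u hu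
    rw [Function.update_of_ne]
    exact fun he => (Finset.mem_erase.1 hu).1 (Fin.ext he)

/-- The common part of the two cases in which a child is treated. -/
theorem insert_of (h : T.Collected H sz r best heavy off) {v : Fin n}
    (hv : v ∉ H) (hr : v ≠ T.root) (hp : T.parent v ∉ H) {r' best' heavy' : ℕ → ℕ}
    (hr' : ∀ u : Fin n, u ≠ T.parent v → r' u = r u)
    (hb' : ∀ u : Fin n, u ≠ T.parent v → best' u = best u)
    (hh' : ∀ u : Fin n, u ≠ T.parent v → heavy' u = heavy u)
    (hle : r' (T.parent v) ≤ sz (T.parent v) + sz v + 1)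
    (hlt : r' (T.parent v) + 1 ≤ T.rpwAt (T.parent v))
    (hchild : ∀ c ∈ insert v H, T.parent c = T.parent v → r c ≤ r' (T.parent v) ∧
      r c + 1 ≤ best' (T.parent v) ∧ (heavy' (T.parent v) ≠ c → r c + 1 ≤ r' (T.parent v)))
    (hbest : ∃ h : Fin n, h ∈ insert v H ∧ heavy' (T.parent v) = h ∧
      T.parent h = T.parent v ∧ best' (T.parent v) = r h + 1) :
    T.Collected (insert v H)
      (Function.update sz (T.parent v) (sz (T.parent v) + sz v + 1)) r' best' heavy'
      (Function.update off v (sz (T.parent v))) := by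
  have hvp : v ≠ T.parent v := fun he =>
    T.not_desc_of_mem_children (T.mem_children.2 ⟨hr, rfl⟩) (by rw [← he]; exact .refl)
  have hsz : ∀ u : Fin n, Function.update sz (T.parent v) (sz (T.parent v) + sz v + 1) u =
      if u = T.parent v then sz (T.parent v) + sz v + 1 else sz u := fun u => by
    simp [Function.update_apply, Fin.val_inj]
  have hoff : ∀ u : Fin n, Function.update off v (sz (T.parent v)) u =
      if u = v then sz (T.parent v) else off u := fun u => by
    simp [Function.update_apply, Fin.val_inj]
  have hne : ∀ {u}, u ∈ insert v H → u ≠ T.parent v := by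
    rintro u hu rfl
    rcases Finset.mem_insert.1 hu with he | hu
    · exact hvp he.symm
    · exact hp hu
  refine ⟨sum_insert h.sum hv hp hvp, fun u => ?_, fun u => ?_, fun c hc => ?_,
    fun c d hc hd hcd hpar => ?_, fun c hc => ?_, fun p => ?_⟩
  · rw [hsz]
    split_ifs with hu
    · rw [hu]; exact hle
    · rw [hr' u hu]; exact h.r_le u
  · by_cases hu : u = T.parent v
    · rw [hu]; exact hlt
    · rw [hr' u hu]; exact h.r_lt u
  · rw [hsz, hsz, hoff, if_neg (hne hc)]
    rcases Finset.mem_insert.1 hc with rfl | hc'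
    · rw [if_pos rfl, if_pos rfl]
    · have h1 := h.nested c hc'
      rw [if_neg (by rintro rfl; exact hv hc')]
      split_ifs with hcv
      · rw [hcv] at h1; omega
      · exact h1
  · rw [hsz, hsz, hoff, hoff, if_neg (hne hc), if_neg (hne hd)]
    rcases Finset.mem_insert.1 hc with rfl | hc' <;> rcases Finset.mem_insert.1 hd with rfl | hd'
    · exact absurd rfl hcd
    · have h1 := h.nested d hd'
      rw [if_pos rfl, if_neg hcd.symm, hpar]
      exact .inr h1
    · have h1 := h.nested c hc'
      rw [if_pos rfl, if_neg hcd, ← hpar]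
      exact .inl h1
    · rw [if_neg (by rintro rfl; exact hv hc'), if_neg (by rintro rfl; exact hv hd')]
      exact h.disjoint c d hc' hd' hcd hpar
  · rw [hr' c (hne hc)]
    by_cases hcv : T.parent c = T.parent v
    · rw [hcv]; exact hchild c hc hcv
    · rw [hr' _ hcv, hb' _ hcv, hh' _ hcv]
      refine h.child c ((Finset.mem_insert.1 hc).resolve_left ?_)
      rintro rfl
      exact hcv rfl
  · by_cases hpv : p = T.parent v
    · subst hpv
      obtain ⟨d, hd, h1, h2, h3⟩ := hbest
      exact .inr ⟨d, hd, h1, h2, by rw [h3, hr' d (hne hd)]⟩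
    · rw [hb' p hpv, hh' p hpv]
      rcases h.best_eq p with h0 | ⟨d, hd, h1, h2, h3⟩
      · exact .inl h0
      · have hd' := Finset.mem_insert_of_mem (b := v) hd
        exact .inr ⟨d, hd', h1, h2, by rw [hr' d (hne hd'), h3]⟩

/-- Treating a child whose bound is at most that of the heavy one. -/
theorem insert_light (h : T.Collected H sz r best heavy off) {v : Fin n}
    (hv : v ∉ H) (hr : v ≠ T.root) (hp : T.parent v ∉ H) (hlt : r v < best (T.parent v))
    {r' : ℕ → ℕ} (hr' : r' = Function.update r (T.parent v) (max (r (T.parent v)) (r v + 1))) :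
    T.Collected (insert v H)
      (Function.update sz (T.parent v) (sz (T.parent v) + sz v + 1)) r' best heavy
      (Function.update off v (sz (T.parent v))) := by
  subst hr'
  obtain h0 | ⟨d, hd, h1, h2, h3⟩ := h.best_eq (T.parent v)
  · omega
  have hself : Function.update r (T.parent v) (max (r (T.parent v)) (r v + 1)) (T.parent v) =
      max (r (T.parent v)) (r v + 1) := Function.update_self ..
  have hvd : v ≠ d := by rintro rfl; exact hv hd
  have hd' : d ∈ insert v H := Finset.mem_insert_of_mem hd
  have hdr : d ≠ T.root := by
    rintro rfl
    exact hp (by rw [← h2, T.parent_root]; exact hd)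
  refine h.insert_of hv hr hp (fun u hu => ?_) (fun _ _ => rfl) (fun _ _ => rfl) ?_ ?_ ?_
    ⟨d, hd', h1, h2, h3⟩ <;> try rw [hself]
  · exact Function.update_of_ne (fun he => hu (Fin.ext he)) _ _
  · have := h.r_le v
    have := h.r_le (T.parent v)
    omega
  · have h4 := h.r_lt (T.parent v)
    have h5 := T.succ_le_rpwAt (T.mem_children.2 ⟨hr, rfl⟩) (T.mem_children.2 ⟨hdr, h2⟩) hvd
      (h.r_lt v) (by have := h.r_lt d; omega)
    omega
  · intro c hc hcv
    rcases Finset.mem_insert.1 hc with rfl | hc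
    · refine ⟨by omega, hlt, fun _ => le_max_right _ _⟩
    · have := h.child c hc
      rw [hcv] at this
      refine ⟨this.1.trans (le_max_left _ _), this.2.1, fun hne => ?_⟩
      exact (this.2.2 hne).trans (le_max_left _ _)

/-- Treating a child whose bound is larger than those of its treated siblings. -/
theorem insert_heavy (h : T.Collected H sz r best heavy off) {v : Fin n}
    (hv : v ∉ H) (hr : v ≠ T.root) (hp : T.parent v ∉ H) (hle : best (T.parent v) ≤ r v) :
    T.Collected (insert v H)
      (Function.update sz (T.parent v) (sz (T.parent v) + sz v + 1))
      (Function.update r (T.parent v) (r v)) (Function.update best (T.parent v) (r v + 1))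
      (Function.update heavy (T.parent v) v)
      (Function.update off v (sz (T.parent v))) := by
  have hupd : ∀ (f : ℕ → ℕ) (k : ℕ) (u : Fin n), u ≠ T.parent v →
      Function.update f (T.parent v) k u = f u := fun f k u hu =>
    Function.update_of_ne (fun he => hu (Fin.ext he)) _ _
  refine h.insert_of hv hr hp (hupd r _) (hupd best _) (hupd heavy _) ?_ ?_ ?_
    ⟨v, Finset.mem_insert_self v H, ?_, rfl, ?_⟩ <;> simp only [Function.update_self]
  · have := h.r_le v
    omega
  · exact (h.r_lt v).trans (T.rpwAt_le_of_mem_children (T.mem_children.2 ⟨hr, rfl⟩))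
  · intro c hc hcv
    rcases Finset.mem_insert.1 hc with rfl | hc
    · exact ⟨le_rfl, le_rfl, fun hne => absurd rfl hne⟩
    · have := h.child c hc
      rw [hcv] at this
      refine ⟨?_, ?_, fun _ => ?_⟩ <;> omega

end Collected
/-! ### Correctness of the upward pass -/

/-- The part of the memory that holds the input. -/
structure HasInput (s : Memory) : Prop where
  size : s.var 0 = n
  root : s.var 1 = T.root
  parent (v : Fin n) : s.arr 0 v = T.parent v

/-- The memory after `i` rounds of `countLoop`. -/
structure Counted (i : ℕ) (s : Memory) : Prop extends T.HasInput s where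
  index : s.var 2 = i
  length : s.var 3 = 0
  count (v : Fin n) : s.arr 3 v = T.pending (Finset.univ.filter fun c : Fin n => (c : ℕ) < i) v
  clean (a j : ℕ) : a ≠ 0 → a ≠ 3 → s.arr a j = 0

/-- The memory after `i` rounds of `leafLoop`. -/
structure Started (i : ℕ) (s : Memory) : Prop extends T.HasInput s where
  index : s.var 2 = i
  queue : T.Queue (fun v => T.pending Finset.univ v = 0 ∧ (v : ℕ) < i) (s.var 3) (s.arr 4)
  count (v : Fin n) : s.arr 3 v = T.pending Finset.univ v
  clean (a j : ℕ) : a ≠ 0 → a ≠ 3 → a ≠ 4 → s.arr a j = 0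

/-- The memory after `i` rounds of `upLoop`, in which the nodes in `H` have been treated. -/
structure Processed (i : ℕ) (H : Finset (Fin n)) (s : Memory) : Prop extends T.HasInput s where
  index : s.var 2 = i
  card : H.card = i
  le_length : i ≤ s.var 3
  mem_iff (v : Fin n) : v ∈ H ↔ ∃ j < i, s.arr 4 j = v
  queue : T.Queue (fun v => T.pending Hᶜ v = 0) (s.var 3) (s.arr 4)
  count (v : Fin n) : s.arr 3 v = T.pending Hᶜ v
  collected : T.Collected H (s.arr 5) (s.arr 6) (s.arr 7) (s.arr 8) (s.arr 9)
  root_X : s.arr 1 T.root = 0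
  root_L : s.arr 10 T.root = 0

variable {T}

theorem Counted.step {B i : ℕ} {s : Memory} (h : T.Counted i s) (hi : i < n) (hB : n + 1 ≤ B) :
    (Expr.lt (.var 2) (.var 0)).eval s ≠ 0 ∧
      countBody.wp B (T.Counted (i + 1)) s := by
  have hpar : s.arr 0 i = T.parent ⟨i, hi⟩ := h.parent ⟨i, hi⟩
  refine ⟨by simp [Expr.eval, h.index, h.size, hi], ?_⟩
  simp only [countBody, Program.wp, Expr.eval, h.index, hpar, h.count]
  have h1 := T.pending_le (Finset.univ.filter fun c : Fin n => (c : ℕ) < i) (T.parent ⟨i, hi⟩)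
  have h2 := (T.parent ⟨i, hi⟩).2
  refine ⟨by omega, by omega, by simp [h.index]; omega, ⟨⟨?_, ?_, ?_⟩, ?_, ?_, ?_, ?_⟩⟩
  · simp [h.size]
  · simp [h.root]
  · simp [h.parent]
  · simp [h.index]
  · simp [h.length]
  · intro v
    have hins : (Finset.univ.filter fun c : Fin n => (c : ℕ) < i + 1) =
        insert ⟨i, hi⟩ (Finset.univ.filter fun c : Fin n => (c : ℕ) < i) := by
      ext c
      simp [Fin.ext_iff]
      omega
    rw [hins, T.pending_insert (by simp)]
    by_cases hv : v = T.parent ⟨i, hi⟩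
    · subst hv; simp
    · simp [Fin.val_inj, hv, h.count]
  · intro a j h0 h3
    simp [h3, h.clean a j h0 h3]

theorem Started.step {B i : ℕ} {s : Memory} (h : T.Started i s) (hi : i < n) (hB : n + 1 ≤ B) :
    (Expr.lt (.var 2) (.var 0)).eval s ≠ 0 ∧
      leafBody.wp B (T.Started (i + 1)) s := by
  have hcount : s.arr 3 i = T.pending Finset.univ ⟨i, hi⟩ := h.count ⟨i, hi⟩
  have hlen := h.queue.length_le
  refine ⟨by simp [Expr.eval, h.index, h.size, hi], ?_⟩
  simp only [leafBody, Program.wp, Expr.eval, h.index, hcount]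
  refine ⟨fun h0 => ⟨by omega, ⟨⟨?_, ?_, ?_⟩, ?_, ?_, ?_, ?_⟩⟩, fun h0 =>
    ⟨by omega, by omega, by simp; omega, by simp [h.index]; omega,
      ⟨⟨?_, ?_, ?_⟩, ?_, ?_, ?_, ?_⟩⟩⟩
  · simp [h.size]
  · simp [h.root]
  · simp [h.parent]
  · simp
  · refine h.queue.congr fun u => and_congr_right fun hu => ?_
    have : (u : ℕ) ≠ i := by rintro rfl; exact h0 hu
    omega
  · simpa using h.count
  · simpa using h.clean
  · simp [h.size]
  · simp [h.root]
  · simp [h.parent]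
  · simp [h.index]
  · refine h.queue.push (v := ⟨i, hi⟩) (by simp)
      (fun c hc => absurd (Finset.mem_univ c) (T.pending_eq_zero.1 h0 c hc)) fun u => ?_
    rw [Fin.ext_iff]
    constructor
    · rintro ⟨h1, h2⟩
      rcases Nat.lt_succ_iff_lt_or_eq.1 h2 with h2 | h2
      · exact .inl ⟨h1, h2⟩
      · exact .inr h2
    · rintro (⟨h1, h2⟩ | h2)
      · exact ⟨h1, by omega⟩
      · obtain rfl : u = ⟨i, hi⟩ := Fin.ext h2
        exact ⟨h0, Nat.lt_succ_self i⟩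
  · simpa using h.count
  · intro a j h0 h3 h4
    simp [h4, h.clean a j h0 h3 h4]

/-- The effect of `absorb`: only arrays `5` to `9` change, and the node `v` joins the treated
ones. -/
theorem absorb_wp {B : ℕ} {H : Finset (Fin n)} {s : Memory}
    (h : T.Collected H (s.arr 5) (s.arr 6) (s.arr 7) (s.arr 8) (s.arr 9)) {v : Fin n}
    (hv : v ∉ H) (hr : v ≠ T.root) (hp : T.parent v ∉ H) (h4 : s.var 4 = v)
    (h5 : s.var 5 = T.parent v) (hB : n + 1 ≤ B) :
    absorb.wp B (fun s' => s'.var = s.var ∧ (∀ a, a ≠ 5 → a ≠ 6 → a ≠ 7 → a ≠ 8 → a ≠ 9 →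
      s'.arr a = s.arr a) ∧ T.Collected (insert v H) (s'.arr 5) (s'.arr 6) (s'.arr 7) (s'.arr 8)
        (s'.arr 9)) s := by
  have hvp : (v : ℕ) ≠ T.parent v := fun he =>
    T.not_desc_of_mem_children (T.mem_children.2 ⟨hr, rfl⟩) (by rw [← Fin.ext he]; exact .refl)
  have hsum := h.sz_add_sz hv hp (fun he => hvp (congrArg _ he))
  have hrv := h.r_le v
  have hvn := v.2
  have hpn := (T.parent v).2
  simp [Program.wp, Expr.eval, absorb, h4, h5, Function.update_of_ne hvp]
  refine ⟨by omega, by omega, by omega, by omega, fun hlt => ⟨fun hle => ⟨by omega, by omega,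
    ?_, ?_⟩, fun hle => ⟨?_, ?_⟩⟩, fun hle => ⟨by omega, by omega, by omega, by omega, by omega,
    by omega, ?_, ?_⟩⟩
  · intro a _ _ _ _ _; simp [*]
  · exact h.insert_light hv hr hp hlt (by rw [max_eq_right (by omega)])
  · intro a _ _ _ _ _; simp [*]
  · exact h.insert_light hv hr hp hlt (by rw [max_eq_left (by omega), Function.update_eq_self])
  · intro a _ _ _ _ _; simp [*]
  · exact h.insert_heavy hv hr hp hle

/-- As long as nodes other than the root are untreated, the queue is not exhausted, and the parent
of the next node is untreated. -/
theorem Processed.exists_next {i : ℕ} {H : Finset (Fin n)} {s : Memory} (h : T.Processed i H s)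
    (hi : i < n - 1) : i < s.var 3 ∧ ∃ v : Fin n, s.arr 4 i = v ∧ v ∉ H ∧ v ≠ T.root ∧
      T.parent v ∉ H := by
  have hne : ∃ v ∈ Hᶜ, v ≠ T.root := by
    by_contra hcon
    push Not at hcon
    have hsub : Finset.univ.erase T.root ⊆ H := fun v hv => by
      by_contra hvH
      exact (Finset.mem_erase.1 hv).1 (hcon v (Finset.mem_compl.2 hvH))
    have := Finset.card_le_card hsub
    rw [Finset.card_erase_of_mem (Finset.mem_univ _), Finset.card_univ, Fintype.card_fin,
      h.card] at this
    omega
  have hlt : i < s.var 3 := by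
    obtain ⟨w, hw, _, h0⟩ := T.exists_pending_eq_zero hne
    obtain ⟨j, hj, hjw⟩ := (h.queue.mem_iff w).2 h0
    by_contra hcon
    exact Finset.mem_compl.1 hw ((h.mem_iff w).2 ⟨j, by omega, hjw⟩)
  obtain ⟨v, hv⟩ := h.queue.node i hlt
  have hvH : v ∉ H := fun hvH => by
    obtain ⟨j, hj, hjv⟩ := (h.mem_iff v).1 hvH
    have := h.queue.inj j i (by omega) hlt (hjv.trans hv.symm)
    omega
  refine ⟨hlt, v, hv, hvH, ?_, fun hp => ?_⟩
  · rintro rfl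
    exact h.queue.ne_root hlt hv
  · obtain ⟨j, hj, hjp⟩ := (h.mem_iff _).1 hp
    obtain ⟨k, hk, hkv⟩ := h.queue.before j v (by omega) hjp
    exact hvH ((h.mem_iff v).2 ⟨k, by omega, hkv⟩)

theorem Processed.step {B i : ℕ} {H : Finset (Fin n)} {s : Memory} (h : T.Processed i H s)
    (hi : i < n - 1) (hB : n + 1 ≤ B) :
    (Expr.lt (.add (.var 2) (.const 1)) (.var 0)).eval s ≠ 0 ∧
      upBody.wp B (fun s => ∃ H, T.Processed (i + 1) H s) s := by
  refine ⟨by simp [Expr.eval, h.index, h.size]; omega, ?_⟩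
  obtain ⟨hit, v, hv, hvH, hvr, hpH⟩ := h.exists_next hi
  have hvn := v.2
  have hpn := (T.parent v).2
  have hlen := h.queue.length_le
  have hpend : ∀ u, T.pending Hᶜ u =
      T.pending (insert v H)ᶜ u + if u = T.parent v then 1 else 0 := fun u => by
    rw [← T.pending_insert (c := v) (by simp), Finset.compl_insert,
      Finset.insert_erase (Finset.mem_compl.2 hvH)]
  have hpend_p := hpend (T.parent v)
  rw [if_pos rfl] at hpend_p
  have hpend_le := T.pending_le Hᶜ (T.parent v)
  have hmem : ∀ u, u ∈ insert v H ↔ ∃ j < i + 1, s.arr 4 j = u := by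
    intro u
    rw [Finset.mem_insert, h.mem_iff]
    constructor
    · rintro (rfl | ⟨j, hj, hju⟩)
      · exact ⟨i, by omega, hv⟩
      · exact ⟨j, by omega, hju⟩
    · rintro ⟨j, hj, hju⟩
      rcases Nat.lt_succ_iff_lt_or_eq.1 hj with hj | rfl
      · exact .inr ⟨j, hj, hju⟩
      · exact .inl (Fin.ext (hju.symm.trans hv))
  have hcard : (insert v H).card = i + 1 := by rw [Finset.card_insert_of_notMem hvH, h.card]
  have hcount : ∀ u : Fin n,
      Function.update (s.arr 3) (T.parent v) (T.pending Hᶜ (T.parent v) - 1) u =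
        T.pending (insert v H)ᶜ u := by
    intro u
    by_cases hu : u = T.parent v
    · subst hu; simp [hpend_p]
    · rw [Function.update_of_ne (fun he => hu (Fin.ext he)), h.count, hpend, if_neg hu, add_zero]
  rw [upBody, Program.wp, Program.wp, Program.wp, Program.wp, Program.wp]
  simp only [Expr.eval, h.index, hv, Memory.var_setVar, Memory.arr_setVar, if_true, h.parent]
  refine ⟨by omega, by omega, Program.wp_mono ?_ (absorb_wp (by exact h.collected)
    hvH hvr hpH (by simp) (by simp) hB)⟩
  rintro s' ⟨hvar, harr, hcol⟩
  have e0 := harr 0 (by simp) (by simp) (by simp) (by simp) (by simp)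
  have e1 := harr 1 (by simp) (by simp) (by simp) (by simp) (by simp)
  have e3 := harr 3 (by simp) (by simp) (by simp) (by simp) (by simp)
  have e4 := harr 4 (by simp) (by simp) (by simp) (by simp) (by simp)
  have e10 := harr 10 (by simp) (by simp) (by simp) (by simp) (by simp)
  simp only [Memory.arr_setVar] at e0 e1 e3 e4 e10
  simp only [Program.wp, Expr.eval, hvar, Memory.var_setVar, Memory.arr_setArr, Memory.var_setArr,
    Nat.reduceEqDiff, if_true, if_false, e3, h.count, Function.update_self,
    h.index]
  refine ⟨by omega, by omega, fun h0 => ⟨by omega, insert v H, ⟨⟨?_, ?_, ?_⟩, ?_, hcard, ?_, ?_,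
    ?_, ?_, ?_, ?_, ?_⟩⟩, fun h0 => ⟨by omega, by omega, by omega, by omega,
    insert v H, ⟨⟨?_, ?_, ?_⟩, ?_, hcard, ?_, ?_, ?_, ?_, ?_, ?_, ?_⟩⟩⟩
  · simp [hvar, h.size]
  · simp [hvar, h.root]
  · simp [e0, h.parent]
  · simp
  · simpa [hvar] using hit
  · simpa [e4] using hmem
  · simp only [Memory.arr_setVar, Memory.arr_setArr, Memory.var_setVar, Memory.var_setArr,
      Nat.reduceEqDiff, if_false, e4, hvar]
    refine h.queue.congr fun u => ?_
    rw [hpend u]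
    by_cases hu : u = T.parent v
    · subst hu; rw [if_pos rfl]; omega
    · rw [if_neg hu, add_zero]
  · simpa [e3] using hcount
  · simpa using hcol
  · simpa [e1] using h.root_X
  · simpa [e10] using h.root_L
  · simp [hvar, h.size]
  · simp [hvar, h.root]
  · simp [e0, h.parent]
  · simp
  · simpa using hit.le
  · intro u
    simp only [Memory.arr_setVar, Memory.arr_setArr, if_true, Nat.reduceEqDiff, if_false, e4, hmem]
    refine exists_congr fun j => and_congr_right fun hj => ?_
    rw [Function.update_of_ne (by omega)]
  · simp only [Memory.arr_setVar, Memory.arr_setArr, Memory.var_setVar, Memory.var_setArr,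
      Nat.reduceEqDiff, if_true, if_false, e4, hvar]
    refine h.queue.push (v := T.parent v) (by omega) (fun c hc => ?_) fun u => ?_
    · have hcm : c ∉ (insert v H)ᶜ := T.pending_eq_zero.1 (by omega) c hc
      rw [Finset.mem_compl, not_not, hmem] at hcm
      obtain ⟨j, hj, hjc⟩ := hcm
      exact (h.queue.mem_iff c).1 ⟨j, by omega, hjc⟩
    · rw [hpend u]
      by_cases hu : u = T.parent v
      · subst hu; exact iff_of_true (by omega) (.inr rfl)
      · simp [hu]
  · simpa [e3] using hcount
  · simpa using hcol
  · simpa [e1] using h.root_X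
  · simpa [e10] using h.root_L

/-! ### Correctness of the downward pass -/

/-- The lowest row of the subtree of a child `c` of `p`, relative to that of the subtree of `p`. The
heavy child comes first, and the siblings that were below it are moved up. -/
def place (sz heavy off : ℕ → ℕ) (p c : ℕ) : ℕ :=
  if c = heavy p then 0
  else if off c < off (heavy p) then off c + (sz (heavy p) + 1) else off c

variable {sz r best heavy off X Y L : ℕ → ℕ}

namespace Collected

variable (h : T.Collected {T.root}ᶜ sz r best heavy off)
include h

theorem sz_root : sz T.root + 1 = n := by
  simpa using h.sum

theorem exists_heavy {c : Fin n} (hc : c ≠ T.root) :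
    ∃ d : Fin n, d ≠ T.root ∧ T.parent d = T.parent c ∧ heavy (T.parent c) = d := by
  have h1 := (h.child c (by simpa using hc)).2.1
  rcases h.best_eq (T.parent c) with h0 | ⟨d, hd, h2, h3, _⟩
  · omega
  · exact ⟨d, by simpa using hd, h3, h2⟩

theorem place_nested {c : Fin n} (hc : c ≠ T.root) :
    place sz heavy off (T.parent c) c + sz c + 1 ≤ sz (T.parent c) := by
  obtain ⟨d, hd, hpar, hh⟩ := h.exists_heavy hc
  have h1 := h.nested c (by simpa using hc)
  have h2 := h.nested d (by simpa using hd)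
  rw [hpar] at h2
  rw [place, hh]
  split_ifs with h3 h4
  · omega
  · have := h.disjoint c d (by simpa using hc) (by simpa using hd)
      (fun he => h3 (congrArg _ he)) hpar.symm
    omega
  · exact h1

theorem place_disjoint {c d : Fin n} (hc : c ≠ T.root) (hd : d ≠ T.root) (hcd : c ≠ d)
    (hpar : T.parent c = T.parent d) :
    place sz heavy off (T.parent c) c + sz c + 1 ≤ place sz heavy off (T.parent d) d ∨
      place sz heavy off (T.parent d) d + sz d + 1 ≤ place sz heavy off (T.parent c) c := by
  obtain ⟨e, he, hpar', hh⟩ := h.exists_heavy hc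
  have h1 := h.disjoint c d (by simpa using hc) (by simpa using hd) hcd hpar
  have h2 : c ≠ e → _ := fun hce =>
    h.disjoint c e (by simpa using hc) (by simpa using he) hce hpar'.symm
  have h3 : d ≠ e → _ := fun hde =>
    h.disjoint d e (by simpa using hd) (by simpa using he) hde (hpar'.trans hpar).symm
  rw [← hpar, place, place, hh]
  by_cases hce : c = e
  · subst hce
    have h4 := h3 hcd.symm
    rw [if_pos rfl, if_neg (fun hv => hcd (Fin.ext hv).symm)]
    split_ifs <;> omega
  · have h5 := h2 hce
    rw [if_neg (fun hv => hce (Fin.ext hv))]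
    by_cases hde : d = e
    · subst hde
      rw [if_pos rfl]
      split_ifs <;> omega
    · have h4 := h3 hde
      rw [if_neg (fun hv => hde (Fin.ext hv))]
      split_ifs <;> omega

end Collected

variable (T) in
/-- The node `v` has its final coordinates, consistent with those of its parent. -/
structure Placed (sz r heavy off X Y L : ℕ → ℕ) (v : Fin n) : Prop where
  Y_eq : Y v = L v + sz v
  row : L v + sz v ≤ sz T.root
  col : X v + r v ≤ r T.root
  child : v ≠ T.root → L v = L (T.parent v) + place sz heavy off (T.parent v) v ∧
    X v = X (T.parent v) + if (v : ℕ) = heavy (T.parent v) then 0 else 1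
  root : v = T.root → X v = 0 ∧ L v = 0

namespace Placed

theorem update_of_ne {u v : Fin n} (hu : T.Placed sz r heavy off X Y L u) (huv : u ≠ v)
    (hpv : u ≠ T.root → T.parent u ≠ v) (a b c : ℕ) :
    T.Placed sz r heavy off (Function.update X v a) (Function.update Y v b)
      (Function.update L v c) u := by
  have hupd : ∀ (f : ℕ → ℕ) (k : ℕ) (w : Fin n), w ≠ v → Function.update f v k w = f w :=
    fun f k w hw => Function.update_of_ne (fun he => hw (Fin.ext he)) _ _
  refine ⟨?_, ?_, ?_, fun hur => ?_, fun hur => ?_⟩ <;> simp only [hupd _ _ u huv]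
  · exact hu.Y_eq
  · exact hu.row
  · exact hu.col
  · simp only [hupd _ _ _ (hpv hur)]
    exact hu.child hur
  · exact hu.root hur

theorem update_self (h : T.Collected {T.root}ᶜ sz r best heavy off) {v : Fin n} (hv : v ≠ T.root)
    (hp : T.Placed sz r heavy off X Y L (T.parent v)) {a c : ℕ}
    (ha : a = X (T.parent v) + if (v : ℕ) = heavy (T.parent v) then 0 else 1)
    (hc : c = L (T.parent v) + place sz heavy off (T.parent v) v) :
    T.Placed sz r heavy off (Function.update X v a) (Function.update Y v (c + sz v))
      (Function.update L v c) v := by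
  have hvp : (T.parent v : ℕ) ≠ v := fun he =>
    T.not_desc_of_mem_children (T.mem_children.2 ⟨hv, rfl⟩) (by rw [Fin.ext he]; exact .refl)
  have h1 := h.place_nested hv
  have h2 := hp.row
  have h3 := hp.col
  have h4 := h.child v (by simpa using hv)
  refine ⟨?_, ?_, ?_, fun hur => ?_, fun hur => absurd hur hv⟩ <;>
    simp only [Function.update_self, Function.update_of_ne hvp]
  · omega
  · split_ifs at ha with hh
    · omega
    · have := h4.2.2 (fun he => hh he.symm)
      omega
  · exact ⟨hc, ha⟩

theorem layout (h : T.Collected {T.root}ᶜ sz r best heavy off)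
    (hpl : ∀ v, T.Placed sz r heavy off X Y L v) : Layout T X Y L where
  le v := by
    have := (hpl v).Y_eq
    omega
  nested c hc := by
    have h1 := (hpl c).Y_eq
    have h2 := (hpl (T.parent c)).Y_eq
    have h3 := ((hpl c).child hc).1
    have h4 := h.place_nested hc
    omega
  disjoint c d hc hd hcd hpar := by
    have h1 := (hpl c).Y_eq
    have h2 := (hpl d).Y_eq
    have h3 := ((hpl c).child hc).1
    have h4 := ((hpl d).child hd).1
    have h5 := h.place_disjoint hc hd hcd hpar
    rw [hpar] at h3 h5
    omega
  step c hc := by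
    have h1 := ((hpl c).child hc).2
    split_ifs at h1
    · exact .inl h1
    · exact .inr h1
  lowest c d hc hd hcd hpar hX := by
    have h1 := (hpl c).Y_eq
    have h2 := ((hpl d).child hd)
    have h3 := ((hpl c).child hc)
    have hcv : (c : ℕ) = heavy (T.parent c) := by
      by_contra hne
      rw [if_neg hne] at h3
      omega
    have hdv : (d : ℕ) ≠ heavy (T.parent d) := fun he =>
      hcd (Fin.ext (by rw [hcv, he, hpar]))
    have h5 := h.place_disjoint hc hd hcd hpar
    have h6 : place sz heavy off (T.parent c) c = 0 := if_pos hcv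
    rw [if_neg hdv] at h2
    rw [hpar] at h3 h5 h6
    omega
  root_X := ((hpl T.root).root rfl).1
  root_L := ((hpl T.root).root rfl).2
  root_Y := by
    have h1 := (hpl T.root).Y_eq
    have h2 := ((hpl T.root).root rfl).2
    have h3 := h.sz_root
    omega
  lt_rpw v := by
    have h1 := (hpl v).col
    have h2 := h.r_lt T.root
    exact Nat.lt_of_lt_of_le (by omega) h2

end Placed

variable (T) in
/-- The memory after `k` rounds of `downLoop`: the root and the last `k` nodes of the queue are
placed. -/
structure Descended (k : ℕ) (s : Memory) : Prop extends T.HasInput s where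
  index : s.var 2 = n - 1 - k
  queue : ∃ ready t, n - 1 ≤ t ∧ T.Queue ready t (s.arr 4)
  covers (v : Fin n) : v ≠ T.root → ∃ j < n - 1, s.arr 4 j = v
  collected : T.Collected {T.root}ᶜ (s.arr 5) (s.arr 6) (s.arr 7) (s.arr 8) (s.arr 9)
  placed (v : Fin n) : (v = T.root ∨ ∃ j, n - 1 - k ≤ j ∧ j < n - 1 ∧ s.arr 4 j = v) →
    T.Placed (s.arr 5) (s.arr 6) (s.arr 8) (s.arr 9) (s.arr 1) (s.arr 2) (s.arr 10) v

theorem Descended.step {B k : ℕ} {s : Memory} (h : T.Descended k s) (hk : k < n - 1)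
    (hB : n + 1 ≤ B) :
    (Expr.lt (.const 0) (.var 2)).eval s ≠ 0 ∧ downBody.wp B (T.Descended (k + 1)) s := by
  refine ⟨by simp [Expr.eval, h.index]; omega, ?_⟩
  obtain ⟨ready, t, ht, hq⟩ := h.queue
  obtain ⟨i, hi⟩ : ∃ i, i = n - 1 - (k + 1) := ⟨_, rfl⟩
  have hidx : s.var 2 - 1 = i := by rw [h.index]; omega
  have hilt : i < n - 1 := by omega
  obtain ⟨v, hv⟩ := hq.node i (by omega)
  have hvr : v ≠ T.root := by rintro rfl; exact hq.ne_root (by omega) hv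
  obtain ⟨d, hd, hpar, hh⟩ := h.collected.exists_heavy hvr
  have hp : T.Placed (s.arr 5) (s.arr 6) (s.arr 8) (s.arr 9) (s.arr 1) (s.arr 2) (s.arr 10)
      (T.parent v) := by
    refine h.placed _ ?_
    by_cases hpr : T.parent v = T.root
    · exact .inl hpr
    · obtain ⟨j, hj, hjp⟩ := h.covers _ hpr
      obtain ⟨j', hj', hjv⟩ := hq.before j v (by omega) hjp
      have := hq.inj j' i (by omega) (by omega) (hjv.trans hv.symm)
      exact .inr ⟨j, by omega, hj, hjp⟩
  obtain ⟨a, ha⟩ : ∃ a, a = s.arr 1 (T.parent v) +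
    if (v : ℕ) = s.arr 8 (T.parent v) then 0 else 1 := ⟨_, rfl⟩
  obtain ⟨c, hc⟩ : ∃ c, c = s.arr 10 (T.parent v) +
    place (s.arr 5) (s.arr 8) (s.arr 9) (T.parent v) v := ⟨_, rfl⟩
  have hpv := hp.update_self h.collected hvr ha hc
  have hca : c + s.arr 5 v ≤ s.arr 5 T.root := by
    simpa using hpv.row
  have haa : a + s.arr 6 v ≤ s.arr 6 T.root := by
    simpa using hpv.col
  have hroot := h.collected.sz_root
  have hroot' := h.collected.r_le T.root
  have hvn := v.2
  have hpn := (T.parent v).2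
  have hdn := d.2
  have key : T.Descended (k + 1)
      (((((((s.setVar 2 i).setVar 4 v).setVar 5 (T.parent v)).setVar 6 d).setArr 1 v a).setArr
        10 v c).setArr 2 v (c + s.arr 5 v)) := by
    refine ⟨⟨?_, ?_, ?_⟩, ?_, ?_, ?_, ?_, fun u hu => ?_⟩
    · simp [h.size]
    · simp [h.root]
    · simp [h.parent]
    · simp [hi]
    · exact ⟨ready, t, ht, by simpa using hq⟩
    · simpa using h.covers
    · simpa using h.collected
    · simp only [Memory.arr_setArr, Memory.arr_setVar, Nat.reduceEqDiff, if_false, if_true] at hu ⊢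
      by_cases huv : u = v
      · rw [huv]; exact hpv
      · have hu' : u = T.root ∨ ∃ j, n - 1 - k ≤ j ∧ j < n - 1 ∧ s.arr 4 j = u := by
          rcases hu with hu | ⟨j, hj, hj', hju⟩
          · exact .inl hu
          · refine .inr ⟨j, ?_, hj', hju⟩
            have : j ≠ i := by
              rintro rfl
              exact huv (Fin.ext (hju.symm.trans hv))
            omega
        refine (h.placed u hu').update_of_ne huv (fun hur hup => ?_) _ _ _
        -- The children of `v` precede `v` in the queue, so they are not placed yet.
        obtain ⟨j, hj, hj', hju⟩ := hu'.resolve_left hur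
        obtain ⟨j₂, hj₂, hju₂⟩ := hq.before i u (by omega) (by rw [hv, hup])
        clear hu hu'
        have := hq.inj j j₂ (by omega) (by omega) (hju.trans hju₂.symm)
        omega
  simp only [downBody, Program.wp, Expr.eval, Memory.var_setVar, Memory.arr_setVar,
    Memory.var_setArr, Memory.arr_setArr, Nat.reduceEqDiff, if_true, if_false, hidx, hv, h.parent,
    hh, Function.update_self]
  refine ⟨by omega, by omega, by omega, by omega, fun he => ?_, fun he => ?_⟩
  · have he' : (v : ℕ) = d := by
      by_contra hne
      exact he (if_neg hne)
    rw [hh, if_pos he', add_zero] at ha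
    rw [place, hh, if_pos he', add_zero] at hc
    rw [← ha, ← hc]
    exact ⟨by omega, by omega, by omega, by omega, by omega, by omega, key⟩
  · have he' : (v : ℕ) ≠ d := by
      intro he'
      rw [if_pos he'] at he
      exact one_ne_zero he
    rw [hh, if_neg he'] at ha
    rw [place, hh, if_neg he'] at hc
    rw [← ha]
    refine ⟨by omega, by omega, fun hlt => ?_, fun hlt => ?_⟩
    · rw [if_pos (by by_contra hne; exact hlt (if_neg hne))] at hc
      rw [← hc]
      exact ⟨by omega, by omega, by omega, by omega, key⟩
    · rw [if_neg (fun hlt' => by rw [if_pos hlt'] at hlt; exact one_ne_zero hlt)] at hc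
      rw [← hc]
      exact ⟨by omega, by omega, by omega, by omega, key⟩

/-! ### Correctness of the algorithm -/

theorem counted_input : T.Counted 0 T.input := by
  refine ⟨⟨rfl, rfl, fun v => ?_⟩, rfl, rfl, fun v => ?_, fun a j h0 _ => ?_⟩
  · simp [RTree.input]
  · simp [RTree.input, pending]
  · simp [RTree.input, h0]

theorem Counted.started {s : Memory} (h : T.Counted n s) : T.Started 0 (s.setVar 2 0) := by
  refine ⟨⟨?_, ?_, ?_⟩, ?_, ?_, ?_, ?_⟩
  · simp [h.size]
  · simp [h.root]
  · simp [h.parent]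
  · simp
  · constructor <;> simp [h.length]
  · intro v
    simp [h.count]
  · intro a j h0 h3 _
    simp [h.clean a j h0 h3]

theorem Started.processed {s : Memory} (h : T.Started n s) :
    T.Processed 0 ∅ (s.setVar 2 0) := by
  have hz : ∀ a, a ≠ 0 → a ≠ 3 → a ≠ 4 → s.arr a = fun _ => 0 := fun a h0 h3 h4 =>
    funext fun j => h.clean a j h0 h3 h4
  refine ⟨⟨?_, ?_, ?_⟩, ?_, ?_, ?_, ?_, ?_, ?_, ?_, ?_, ?_⟩
  · simp [h.size]
  · simp [h.root]
  · simp [h.parent]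
  · simp
  · simp
  · simp
  · simp
  · simpa using h.queue
  · simpa using h.count
  · simpa [hz] using Collected.init
  · simp [hz]
  · simp [hz]

theorem Processed.descended {H : Finset (Fin n)} {s : Memory} (h : T.Processed (n - 1) H s) :
    T.Descended 0 (s.setArr 2 T.root (s.arr 5 T.root)) := by
  have hr : T.root ∉ H := fun hr => by
    obtain ⟨j, hj, hjr⟩ := (h.mem_iff _).1 hr
    exact h.queue.ne_root (hj.trans_le h.le_length) hjr
  have hH : H = {T.root}ᶜ := by
    refine Finset.eq_of_subset_of_card_le (fun v hv => ?_) ?_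
    · rw [Finset.mem_compl, Finset.mem_singleton]
      rintro rfl
      exact hr hv
    · simp [Finset.card_compl, h.card]
  subst hH
  refine ⟨⟨?_, ?_, ?_⟩, ?_, ⟨_, s.var 3, h.le_length, h.queue⟩, fun v hv => ?_, ?_,
    fun v hv => ?_⟩
  · simp [h.size]
  · simp [h.root]
  · simp [h.parent]
  · simp [h.index]
  · simpa using (h.mem_iff v).1 (by simpa using hv)
  · simpa using h.collected
  · obtain rfl : v = T.root := hv.resolve_right (by rintro ⟨j, hj, hj', _⟩; omega)
    refine ⟨?_, ?_, ?_, fun hne => absurd rfl hne, fun _ => ?_⟩ <;> simp [h.root_X, h.root_L]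

theorem runs_drawTree (T : RTree n) :
    Program.Runs (1000 * n) drawTree T.input (1000 * n) fun s =>
      ∃ L, Layout T (s.arr 1) (s.arr 2) L := by
  have hn : 0 < n := T.root.pos
  have hB : n + 1 ≤ 1000 * n := by omega
  have hcount : Program.Runs (1000 * n) countLoop T.input _ (T.Counted n) :=
    .loop T.Counted (fun i hi s hs => hs.step hi hB)
      (fun s hs => by simp [Expr.eval, hs.index, hs.size]) counted_input
  have hleaf (s) (hs : T.Started 0 s) : Program.Runs (1000 * n) leafLoop s _ (T.Started n) :=
    .loop T.Started (fun i hi s hs => hs.step hi hB)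
      (fun s hs => by simp [Expr.eval, hs.index, hs.size]) hs
  have hup (s) (hs : T.Processed 0 ∅ s) :
      Program.Runs (1000 * n) upLoop s _ (fun s => ∃ H, T.Processed (n - 1) H s) :=
    .loop (fun i s => ∃ H, T.Processed i H s) (fun i hi s ⟨H, hs⟩ => hs.step hi hB)
      (fun s ⟨H, hs⟩ => by simp [Expr.eval, hs.index, hs.size]; omega) ⟨∅, hs⟩
  have hdown (s) (hs : T.Descended 0 s) :
      Program.Runs (1000 * n) downLoop s _ (T.Descended (n - 1)) :=
    .loop T.Descended (fun i hi s hs => hs.step hi hB)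
      (fun s hs => by simp [Expr.eval, hs.index]) hs
  have hreset (s) : Program.wp (1000 * n) (.assign 2 (.const 0)) (· = s.setVar 2 0) s :=
    ⟨Nat.zero_le _, rfl⟩
  have hroot (s) (hs : ∃ H, T.Processed (n - 1) H s) :
      Program.wp (1000 * n) (.store 2 (.var 1) (.get 5 (.var 1))) (T.Descended 0) s := by
    obtain ⟨H, hs⟩ := hs
    have h1 := T.root.2
    have h2 := hs.descended
    have h3 := h2.collected.sz_root
    simp only [Memory.arr_setArr, Nat.reduceEqDiff, if_false] at h3
    simp only [Program.wp, Expr.eval, hs.root]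
    exact ⟨by omega, by omega, h2⟩
  have hfinal (s) (hs : T.Descended (n - 1) s) : ∃ L, Layout T (s.arr 1) (s.arr 2) L := by
    refine ⟨s.arr 10, Placed.layout hs.collected fun v => hs.placed v ?_⟩
    by_cases hv : v = T.root
    · exact .inl hv
    · obtain ⟨j, hj, hjv⟩ := hs.covers v hv
      exact .inr ⟨j, by omega, hj, hjv⟩
  have hrun := hcount.seq fun s hs => (Program.Runs.of_wp (hreset s)).seq fun s' hs' =>
    (hleaf s' (hs' ▸ hs.started)).seq fun s hs => (Program.Runs.of_wp (hreset s)).seq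
    fun s' hs' => (hup s' (hs' ▸ hs.processed)).seq fun s hs =>
    (Program.Runs.of_wp (hroot s hs)).seq hdown
  obtain ⟨t, s, h1, h2, h3⟩ := hrun
  refine ⟨t, s, h1, h2.trans ?_, hfinal s h3⟩
  -- `1000` exceeds the total cost of one round of each loop and of the steps outside the loops.
  simp [countBody, leafBody, upBody, downBody, absorb, Program.maxTime, Expr.cost]
  omega

end RTree
end TreeDrawing

theorem mainTheorem2 :
    (∀ (n : ℕ) (T : TreeDrawing.RTree n),
      IsLeast {W : ℕ | ∃ Γ : TreeDrawing.Drawing T, Γ.IsPlanar ∧ Γ.IsUpward ∧ Γ.width = W}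
        T.rpw) ∧
    (∃ (P : TreeDrawing.Program) (C : ℕ), ∀ (n : ℕ) (T : TreeDrawing.RTree n),
      ∃ (t : ℕ) (s : TreeDrawing.Memory),
        TreeDrawing.Exec (C * n) P T.input t s ∧ t ≤ C * n ∧
        (s.output T).IsPlanar ∧
        (s.output T).IsStrictlyUpward ∧
        (s.output T).IsStraightLine ∧
        (s.output T).IsGrid ∧
        (s.output T).width = T.rpw ∧
        (s.output T).height = n ∧
        (s.output T).RootTopLeft) := by
  refine ⟨fun n T => ⟨?_, ?_⟩, TreeDrawing.drawTree, 1000, fun n T => ?_⟩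
  · obtain ⟨t, s, _, _, L, h⟩ := T.runs_drawTree
    exact ⟨s.output T, h.isPlanar, fun v hv => (h.isStrictlyUpward v hv).imp le_of_lt, h.width_eq⟩
  · rintro W ⟨Γ, hplanar, hup, rfl⟩
    exact hplanar.rpw_le_width hup
  · obtain ⟨t, s, hexec, ht, L, h⟩ := T.runs_drawTree
    exact ⟨t, s, hexec, ht, h.isPlanar, h.isStrictlyUpward, fun _ _ => rfl,
      TreeDrawing.Layout.isGrid, h.width_eq, h.height_eq, h.rootTopLeft⟩
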